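/- A graph here is a finite multigraph (loops and multiple edges allowed) with $s$ labelled legs $1,\dots,s$, each attached to a vertex. It is admissible if it is connected, stays connected after removing any single internal edge, and every vertex has valency at least $3$ (loops count twice, legs count once). Let $\widetilde X_s=\mathcal{MHG}_{1,s}$ be the moduli space of one-loop holocolored graphs with $s$ legs. Its points are equivalence classes of triples $(G,\lambda,c)$ where $G$ is an admissible graph with $s$ legs and first Betti number $1$, $c:E(G)\to\{1,\dots,s\}$ is an injective coloring of the internal edges, and $\lambda:E(G)\to\mathbb R_{\ge 0}$ is a metric of total volume $1$ that vanishes only on a forest. Two triples $(G,\lambda,c)$ and $(G',\lambda',c')$ are equivalent if, after collapsing all edges of length zero, there is an isomorphism of graphs between them that preserves the labelled legs, the colors and the lengths. The space $\widetilde X_s$ carries the quotient topology of the disjoint union, over all $(G,c)$, of the spaces of metrics. Let $s\ge 0$. Then $\widetilde X_s$ is a $\Delta$-complex whose $(k-1)$-simplices are the simplices of all metrics of volume one on the holocolored graphs $(G,c)$ as above with $k$ internal edges (one simplex for each isomorphism class of such $(G,c)$). For every such $\Delta$-complex structure and every $k\ge 1$, the number of $(k-1)$-simplices is finite and equal to $$N_{k,s}=\frac{(k-1)!}{2-\delta_{k,1}}\binom{s}{k}\sum_{j=0}^{k}(-1)^{k-j}\binom{k}{j}j^s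 ,$$ where $0^0=1$. Hence the Euler characteristic $\chi(\widetilde X_s)=\sum_{i\ge0}(-1)^i\dim H_i(\widetilde X_s;\mathbb Q)$, with $H_i$ the simplicial homology of the $\Delta$-complex, is $$\chi(\widetilde X_s)=\sum_{k=1}^{s}\sum_{j=0}^{k}(-1)^{j+1}\,\frac{j^s\,(k-1)!}{2-\delta_{k,1}}\binom{s}{k}\binom{k}{j}.$$ -/

import Mathlib

open Topology

/-! ### Finite multigraphs with labelled legs -/

/-- A finite multigraph (loops and multiple edges allowed) with `s` legs: every internal edge has
an unordered pair of ends, and the `i`-th leg is a labelled basepoint at the vertex `leg i`. -/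
structure LegGraph (s : ℕ) where
  V : Type
  E : Type
  [finiteV : Finite V]
  [finiteE : Finite E]
  ends : E → Sym2 V
  leg : Fin s → V

namespace LegGraph

variable {s : ℕ}

instance (G : LegGraph s) : Finite G.V := G.finiteV
instance (G : LegGraph s) : Finite G.E := G.finiteE

noncomputable instance (G : LegGraph s) : Fintype G.E := Fintype.ofFinite _

/-- Two vertices are related if they are joined by a path all of whose edges are in `Z`. -/
def conn (G : LegGraph s) (Z : Set G.E) : Setoid G.V :=
  Relation.EqvGen.setoid fun v w => ∃ e ∈ Z, G.ends e = s(v, w)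

/-- The connected components of the spanning subgraph `(V, Z)`. -/
def Comps (G : LegGraph s) (Z : Set G.E) : Type := Quotient (G.conn Z)

instance (G : LegGraph s) (Z : Set G.E) : Finite (G.Comps Z) :=
  inferInstanceAs (Finite (Quotient (G.conn Z)))

/-- The first Betti number of the spanning subgraph with edge set `Z`. -/
noncomputable def betti (G : LegGraph s) (Z : Set G.E) : ℤ :=
  (Z.ncard : ℤ) - Nat.card G.V + Nat.card (G.Comps Z)

/-- The loop number `h₁(G)`. -/
noncomputable def rank (G : LegGraph s) : ℤ := G.betti Set.univ

/-- The spanning subgraph with edge set `Z` has no loops. -/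
def IsForest (G : LegGraph s) (Z : Set G.E) : Prop := G.betti Z = 0

/-- The spanning subgraph with edge set `Z` is non-empty and connected. -/
def ConnectedOn (G : LegGraph s) (Z : Set G.E) : Prop := Nat.card (G.Comps Z) = 1

/-- One-particle irreducible: connected, and still connected upon removal of any edge. -/
def IsOnePI (G : LegGraph s) : Prop :=
  G.ConnectedOn Set.univ ∧ ∀ e : G.E, G.ConnectedOn {e}ᶜ

/-- The valency of `v`: the number of half-edges at `v`. Loops count twice, legs count once. -/
noncomputable def valency (G : LegGraph s) (v : G.V) : ℕ :=
  Nat.card {e : G.E // v ∈ G.ends e} + Nat.card {e : G.E // G.ends e = s(v, v)} +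
    Nat.card {i : Fin s // G.leg i = v}

/-- Admissible graphs: one-particle irreducible with all valencies at least three. -/
def IsAdmissible (G : LegGraph s) : Prop := G.IsOnePI ∧ ∀ v, 3 ≤ G.valency v

/-- The graph `G / Z`: every connected component of `(V, Z)` is collapsed to a vertex and the
edges of `Z` disappear. -/
def contract (G : LegGraph s) (Z : Set G.E) : LegGraph s where
  V := G.Comps Z
  E := {e : G.E // e ∉ Z}
  ends e := (G.ends e.1).map (Quotient.mk (G.conn Z))
  leg i := Quotient.mk (G.conn Z) (G.leg i)

/-- Isomorphisms of graphs with legs; they preserve every labelled leg. -/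
structure Iso (G G' : LegGraph s) where
  onV : G.V ≃ G'.V
  onE : G.E ≃ G'.E
  ends_onE : ∀ e, G'.ends (onE e) = (G.ends e).map onV
  leg_eq : ∀ i, G'.leg i = onV (G.leg i)

namespace Iso

def refl (G : LegGraph s) : Iso G G where
  onV := Equiv.refl _
  onE := Equiv.refl _
  ends_onE e := by simp
  leg_eq i := rfl

def symm {G G' : LegGraph s} (φ : Iso G G') : Iso G' G where
  onV := φ.onV.symm
  onE := φ.onE.symm
  ends_onE e := by
    have h := φ.ends_onE (φ.onE.symm e)
    rw [Equiv.apply_symm_apply] at h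
    rw [h, Sym2.map_map]
    simp
  leg_eq i := by rw [φ.leg_eq i, Equiv.symm_apply_apply]

def trans {G G' G'' : LegGraph s} (φ : Iso G G') (ψ : Iso G' G'') : Iso G G'' where
  onV := φ.onV.trans ψ.onV
  onE := φ.onE.trans ψ.onE
  ends_onE e := by
    rw [Equiv.trans_apply, ψ.ends_onE, φ.ends_onE, Sym2.map_map]
    rfl
  leg_eq i := by rw [ψ.leg_eq, φ.leg_eq]; rfl

end Iso

end LegGraph

/-! ### Moduli spaces of holocolored graphs -/

/-- An admissible graph of rank `n` with `s` legs together with an injective coloring of its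
edges by the `3 (n - 1) + s` colors. -/
structure HoloGraph (n s : ℕ) extends LegGraph s where
  admissible : toLegGraph.IsAdmissible
  rank_eq : toLegGraph.rank = n
  color : E → Fin (3 * (n - 1) + s)
  color_injective : Function.Injective color

/-- A holocolored graph with a metric of volume one that vanishes only on a forest. -/
structure MetricHoloGraph (n s : ℕ) where
  graph : HoloGraph n s
  metric : {l : stdSimplex ℝ graph.E // graph.IsForest {e | l e = 0}}

namespace MetricHoloGraph

variable {n s : ℕ}

/-- The set of edges of length zero. -/
def zeroSet (x : MetricHoloGraph n s) : Set x.graph.E := {e | x.metric.1 e = 0}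

/-- Two colored metric graphs are equivalent if, after collapsing all edges of length zero, there
is an isomorphism between them that preserves legs, colors and lengths. -/
instance setoid (n s : ℕ) : Setoid (MetricHoloGraph n s) where
  r x y := ∃ φ : LegGraph.Iso (x.graph.contract x.zeroSet) (y.graph.contract y.zeroSet),
    ∀ e : {e : x.graph.E // e ∉ x.zeroSet},
      y.graph.color (φ.onE e).1 = x.graph.color e.1 ∧
      y.metric.1 (φ.onE e).1 = x.metric.1 e.1
  iseqv :=
    { refl := fun x => ⟨LegGraph.Iso.refl _, fun _ => ⟨rfl, rfl⟩⟩
      symm := by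
        rintro x y ⟨φ, h⟩
        refine ⟨φ.symm, fun e => ?_⟩
        have h' := h (φ.onE.symm e)
        have he : φ.onE (φ.onE.symm e) = e := φ.onE.apply_symm_apply e
        rw [he] at h'
        exact ⟨h'.1.symm, h'.2.symm⟩
      trans := by
        rintro x y z ⟨φ, h⟩ ⟨ψ, k⟩
        exact ⟨φ.trans ψ, fun e => ⟨(k (φ.onE e)).1.trans (h e).1, (k (φ.onE e)).2.trans (h e).2⟩⟩ }

end MetricHoloGraph

/-- The disjoint union topology, over all holocolored graphs, of the spaces of metrics. -/
instance (n s : ℕ) : TopologicalSpace (MetricHoloGraph n s) :=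
  ⨆ Γ : HoloGraph n s, TopologicalSpace.coinduced (MetricHoloGraph.mk Γ) inferInstance

/-- The moduli space of holocolored graphs of rank `n` with `s` legs, with the quotient
topology. -/
def MHG (n s : ℕ) : Type 1 := Quotient (MetricHoloGraph.setoid n s)

instance (n s : ℕ) : TopologicalSpace (MHG n s) :=
  inferInstanceAs (TopologicalSpace (Quotient (MetricHoloGraph.setoid n s)))

/-- The point of the moduli space represented by a colored metric graph. -/
def MHG.mk {n s : ℕ} (x : MetricHoloGraph n s) : MHG n s :=
  Quotient.mk (MetricHoloGraph.setoid n s) x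

/-! ### Δ-complexes and their Euler characteristic -/

universe u

/-- A Δ-complex structure on a topological space `X`: a family of continuous maps from standard
simplices to `X` such that every point of `X` is the image of exactly one point in the interior of
one of the simplices, the restriction of a map of the family to a face (parametrized in the order
preserving way) is in the family, and a subset of `X` is open if and only if all its preimages
are open. -/
structure DeltaComplex (X : Type u) [TopologicalSpace X] where
  cell : ℕ → Type u
  map : ∀ {n : ℕ}, cell n → C(stdSimplex ℝ (Fin (n + 1)), X)
  existsUnique_interior : ∀ x : X, ∃! p : Σ n : ℕ, cell n × stdSimplex ℝ (Fin (n + 1)),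
    (∀ i, 0 < p.2.2 i) ∧ map p.2.1 p.2.2 = x
  face : ∀ {n : ℕ}, cell (n + 1) → Fin (n + 2) → cell n
  map_face : ∀ {n : ℕ} (a : cell (n + 1)) (i : Fin (n + 2)) (t : stdSimplex ℝ (Fin (n + 1))),
    map (face a i) t = map a (stdSimplex.map i.succAbove t)
  isOpen_iff : ∀ A : Set X, IsOpen A ↔ ∀ (n : ℕ) (a : cell n), IsOpen (map a ⁻¹' A)

namespace DeltaComplex

variable {X : Type u} [TopologicalSpace X] (K : DeltaComplex X)

theorem cell_ext {n : ℕ} {a b : K.cell n} (h : ∀ t, K.map a t = K.map b t) : a = b := by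
  classical
  let t : stdSimplex ℝ (Fin (n + 1)) := stdSimplex.barycenter
  have ht : ∀ i, 0 < t i := fun i => by
    have : t i = (Fintype.card (Fin (n + 1)) : ℝ)⁻¹ := stdSimplex.barycenter_apply i
    rw [this]
    simp only [Fintype.card_fin]
    positivity
  have := (K.existsUnique_interior (K.map b t)).unique
    (y₁ := ⟨n, a, t⟩) (y₂ := ⟨n, b, t⟩) ⟨ht, h t⟩ ⟨ht, rfl⟩
  simpa using this

theorem face_face {n : ℕ} (a : K.cell (n + 2)) {i j : Fin (n + 2)} (h : i ≤ j) :
    K.face (K.face a j.succ) i = K.face (K.face a i.castSucc) j := by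
  apply K.cell_ext
  intro t
  rw [K.map_face, K.map_face, K.map_face, K.map_face, stdSimplex.map_comp_apply,
    stdSimplex.map_comp_apply]
  congr 2
  funext k
  have := SimplexCategory.δ_comp_δ h
  have h2 := congrArg (fun f => SimplexCategory.Hom.toOrderHom f k) this
  simpa [SimplexCategory.δ] using h2

/-- The simplicial boundary operator `∂ a = ∑ᵢ (-1)ⁱ (i-th face of a)` on rational chains. -/
noncomputable def boundary (n : ℕ) : (K.cell (n + 1) →₀ ℚ) →ₗ[ℚ] (K.cell n →₀ ℚ) :=
  Finsupp.linearCombination ℚ fun a =>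
    ∑ i : Fin (n + 2), (-1 : ℚ) ^ (i : ℕ) • Finsupp.single (K.face a i) (1 : ℚ)

theorem boundary_comp_boundary (n : ℕ) : K.boundary n ∘ₗ K.boundary (n + 1) = 0 := by
  refine Finsupp.lhom_ext' fun a => LinearMap.ext_ring ?_
  simp only [boundary, LinearMap.comp_apply, Finsupp.lsingle_apply,
    Finsupp.linearCombination_single, map_sum, map_smul, Finset.smul_sum, smul_smul,
    LinearMap.zero_apply]
  rw [Finset.sum_comm, ← Finset.sum_product', Finset.univ_product_univ]
  let S : Finset (Fin (n + 2) × Fin (n + 3)) := {p | (p.2 : ℕ) ≤ (p.1 : ℕ)}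
  rw [← Finset.sum_add_sum_compl S, ← eq_neg_iff_add_eq_zero, ← Finset.sum_neg_distrib]
  refine Finset.sum_bij (fun p hp => (p.2.castLT
    (lt_of_le_of_lt (Finset.mem_filter.mp hp).2 p.1.isLt), p.1.succ)) ?_ ?_ ?_ ?_
  · intro p hp
    simp only [S, Finset.compl_filter, Finset.mem_filter_univ, Fin.val_succ,
      Fin.val_castLT] at hp ⊢
    lia
  · rintro ⟨i, j⟩ hp ⟨i', j'⟩ hp' h
    simp only [Prod.mk.injEq, Fin.ext_iff, Fin.val_castLT] at h ⊢
    simp only [Fin.val_succ] at h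
    lia
  · rintro ⟨i, j⟩ hp
    simp only [S, Finset.compl_filter, Finset.mem_filter_univ, not_le] at hp
    refine ⟨(j.pred ?_, i.castSucc), ?_, ?_⟩
    · rintro rfl
      simp at hp
    · simpa [S] using Nat.le_sub_one_of_lt hp
    · simp
  · rintro ⟨i, j⟩ hp
    have hij : (j : ℕ) ≤ i := by simpa [S] using hp
    have key := K.face_face a (i := j.castLT (lt_of_le_of_lt hij i.isLt)) (j := i) hij
    rw [Fin.castSucc_castLT] at key
    simp only [key, Fin.val_succ, Fin.val_castLT, ← neg_smul]
    congr 1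
    ring

/-- The rational simplicial chain complex of a Δ-complex. -/
noncomputable def chainComplex : ChainComplex (ModuleCat.{u} ℚ) ℕ :=
  ChainComplex.of (fun n => ModuleCat.of ℚ (K.cell n →₀ ℚ))
    (fun n => ModuleCat.ofHom (K.boundary n))
    (fun n => by
      rw [← ModuleCat.ofHom_comp, K.boundary_comp_boundary]
      rfl)

/-- The Euler characteristic `χ = ∑ₙ (-1)ⁿ dim Hₙ` of a Δ-complex. -/
noncomputable def eulerChar : ℤ := K.chainComplex.homologyEulerChar

end DeltaComplex

/-- The simplices of the Δ-complex structure `K` are those of colored graphs: each simplex of `K`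
is the family of all metrics of volume one on some holocolored graph `Γ`, its vertices being
numbered by the edges of `Γ`, and every holocolored graph occurs in this way. -/
structure DeltaComplex.IsGraphComplex {s : ℕ} (K : DeltaComplex (MHG 1 s)) : Prop where
  exists_graph : ∀ (n : ℕ) (a : K.cell n), ∃ (Γ : HoloGraph 1 s) (f : Fin (n + 1) ≃ Γ.E),
    ∀ t, ∃ h, K.map a t = MHG.mk ⟨Γ, stdSimplex.map f t, h⟩
  exists_cell : ∀ Γ : HoloGraph 1 s, ∃ (n : ℕ) (a : K.cell n) (f : Fin (n + 1) ≃ Γ.E),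
    ∀ t, ∃ h, K.map a t = MHG.mk ⟨Γ, stdSimplex.map f t, h⟩

/-! A one-particle irreducible graph with one loop has as many edges as vertices, and the handshake
lemma gives every vertex edge-degree 2, so it is a cycle. Such a graph is admissible exactly when
every vertex carries a leg (`isAdmissible_iff`), and each proper set of its edges is a forest. Hence
every metric of volume one is allowed, the simplices are closed, and collapsing a proper set of
edges gives another graph of the same kind. Injective colors order the edges canonically and rule
out nontrivial symmetries of the metric, so the simplices indexed by isomorphism classes glue to a
Δ-complex (`deltaComplex`).

To count classes with `k` edges, consider colorings `ZMod k ↪ Fin s` together with surjections `Fin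
s → ZMod k`. There are `k! * s.choose k` times the number of surjections of these, and each
describes a colored cycle. The data describing a given graph correspond to its cyclic numberings
(`card_fiber`), and these to its flags (`flag_bijective`): a starting vertex and an incident edge.
There are `2 * k` of them, or one if `k = 1`. Dividing gives the formula.

Any other Δ-complex structure of the required kind has cells in bijection with the isomorphism
classes (`nonempty_equiv`, by comparing barycenters). The Euler characteristic is then the
alternating sum of cell numbers, by rank-nullity and telescoping. -/

namespace LegGraph

variable {s : ℕ}

/-! ### Connectivity and contractions of graphs. -/

theorem conn_of_mem {G : LegGraph s} {Z : Set G.E} {e : G.E} {v w : G.V} (he : e ∈ Z)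
    (h : G.ends e = s(v, w)) : G.conn Z v w :=
  Relation.EqvGen.rel _ _ ⟨e, he, h⟩

theorem conn_le {G : LegGraph s} {Z : Set G.E} {r : Setoid G.V}
    (h : ∀ e ∈ Z, ∀ v w, G.ends e = s(v, w) → r v w) : G.conn Z ≤ r :=
  Setoid.eqvGen_le fun v w ⟨e, he, h'⟩ => h e he v w h'

theorem conn_mono {G : LegGraph s} {Z W : Set G.E} (h : Z ⊆ W) : G.conn Z ≤ G.conn W :=
  conn_le fun _ he _ _ h' => conn_of_mem (h he) h'

theorem conn_empty {G : LegGraph s} {v w : G.V} : G.conn ∅ v w ↔ v = w := by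
  refine ⟨fun h => ?_, fun h => h ▸ (G.conn ∅).refl v⟩
  exact conn_le (r := (⊥ : Setoid G.V)) (fun e he => he.elim) h

theorem connectedOn_iff {G : LegGraph s} {Z : Set G.E} :
    G.ConnectedOn Z ↔ Nonempty G.V ∧ ∀ v w, G.conn Z v w := by
  unfold ConnectedOn Comps
  rw [Nat.card_eq_one_iff_unique]
  constructor
  · rintro ⟨h, ⟨q⟩⟩
    exact ⟨⟨q.out⟩, fun v w => Quotient.exact (h.elim (Quotient.mk _ v) (Quotient.mk _ w))⟩
  · rintro ⟨⟨v⟩, h⟩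
    exact ⟨⟨fun a b => Quotient.inductionOn₂ a b fun v w => Quotient.sound (h v w)⟩,
      ⟨Quotient.mk _ v⟩⟩

/-- A contraction of a graph onto another one, which keeps the legs and whose fibres are the
connected components of the edges that disappear. -/
structure Contraction (G H : LegGraph s) where
  onV : G.V → H.V
  onE : H.E → G.E
  onV_surjective : Function.Surjective onV
  onE_injective : Function.Injective onE
  ends_eq : ∀ e, H.ends e = (G.ends (onE e)).map onV
  leg_eq : ∀ i, H.leg i = onV (G.leg i)
  onV_eq_iff : ∀ v w, onV v = onV w ↔ G.conn (Set.range onE)ᶜ v w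

namespace Contraction

variable {G H K : LegGraph s}

/-- A path in the target lifts once its consecutive edges are joined inside the fibres, which are
connected by the discarded edges. Conversely, discarded edges become constant paths. -/
theorem conn_iff (p : Contraction G H) (W : Set H.E) (v w : G.V) :
    H.conn W (p.onV v) (p.onV w) ↔ G.conn ((Set.range p.onE)ᶜ ∪ p.onE '' W) v w := by
  have hle : G.conn (Set.range p.onE)ᶜ ≤ G.conn ((Set.range p.onE)ᶜ ∪ p.onE '' W) :=
    conn_mono Set.subset_union_left
  constructor
  · let r : Setoid H.V :=
      { r := fun a b => ∀ v w, p.onV v = a → p.onV w = b →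
          G.conn ((Set.range p.onE)ᶜ ∪ p.onE '' W) v w
        iseqv :=
          { refl := fun a v w hv hw => hle ((p.onV_eq_iff v w).1 (hv.trans hw.symm))
            symm := fun h v w hv hw => (G.conn _).symm (h w v hw hv)
            trans := fun {a b c} h k v w hv hw => by
              obtain ⟨u, hu⟩ := p.onV_surjective b
              exact (G.conn _).trans (h v u hv hu) (k u w hu hw) } }
    have hr : H.conn W ≤ r := by
      refine conn_le fun e he a b hab v w hv hw => ?_
      rw [p.ends_eq] at hab
      induction hG : G.ends (p.onE e) with
      | _ x y =>
        have hxy := conn_of_mem (Z := (Set.range p.onE)ᶜ ∪ p.onE '' W)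
          (Or.inr ⟨e, he, rfl⟩) hG
        rw [hG, Sym2.map_mk, Sym2.eq_iff] at hab
        rcases hab with ⟨h1, h2⟩ | ⟨h1, h2⟩
        · exact (G.conn _).trans (hle ((p.onV_eq_iff v x).1 (hv.trans h1.symm)))
            ((G.conn _).trans hxy (hle ((p.onV_eq_iff y w).1 (h2.trans hw.symm))))
        · exact (G.conn _).trans (hle ((p.onV_eq_iff v y).1 (hv.trans h2.symm)))
            ((G.conn _).trans ((G.conn _).symm hxy)
              (hle ((p.onV_eq_iff x w).1 (h1.trans hw.symm))))
    exact fun h => hr h v w rfl rfl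
  · refine fun h => conn_le (r := (H.conn W).comap p.onV) ?_ h
    rintro e (he | ⟨f, hf, rfl⟩) v w hvw
    · have : p.onV v = p.onV w := (p.onV_eq_iff v w).2 (conn_of_mem he hvw)
      change H.conn W (p.onV v) (p.onV w)
      rw [this]
    · refine conn_of_mem hf ?_
      rw [p.ends_eq, hvw, Sym2.map_mk]

theorem connectedOn_iff (p : Contraction G H) (W : Set H.E) :
    H.ConnectedOn W ↔ G.ConnectedOn ((Set.range p.onE)ᶜ ∪ p.onE '' W) := by
  rw [LegGraph.connectedOn_iff, LegGraph.connectedOn_iff]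
  refine and_congr ⟨fun ⟨v⟩ => ⟨(p.onV_surjective v).choose⟩, fun ⟨v⟩ => ⟨p.onV v⟩⟩ ?_
  simp only [← p.conn_iff, p.onV_surjective.forall]

theorem card_V (p : Contraction G H) : Nat.card H.V = Nat.card (G.Comps (Set.range p.onE)ᶜ) := by
  symm
  refine Nat.card_congr (Equiv.ofBijective
    (Quotient.lift p.onV fun v w h => (p.onV_eq_iff v w).2 h) ⟨?_, fun v => ?_⟩)
  · intro a b
    refine Quotient.inductionOn₂ a b fun v w h => Quotient.sound ((p.onV_eq_iff v w).1 h)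
  · obtain ⟨w, rfl⟩ := p.onV_surjective v
    exact ⟨Quotient.mk _ w, rfl⟩

/-- The contraction of the components of `(V, Z)`. -/
def ofSet (G : LegGraph s) (Z : Set G.E) : Contraction G (G.contract Z) where
  onV := Quotient.mk (G.conn Z)
  onE := Subtype.val
  onV_surjective := Quotient.mk_surjective
  onE_injective := Subtype.val_injective
  ends_eq _ := rfl
  leg_eq _ := rfl
  onV_eq_iff v w := by
    have : (Set.range (Subtype.val : {e : G.E // e ∉ Z} → G.E))ᶜ = Z := by
      rw [Subtype.range_coe_subtype]
      ext; simp
    erw [this]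
    exact Quotient.eq

theorem range_ofSet (G : LegGraph s) (Z : Set G.E) : Set.range (ofSet G Z).onE = Zᶜ :=
  Subtype.range_coe_subtype

/-- An isomorphism is a contraction. -/
def ofIso (φ : Iso G H) : Contraction G H where
  onV := φ.onV
  onE := φ.onE.symm
  onV_surjective := φ.onV.surjective
  onE_injective := φ.onE.symm.injective
  ends_eq e := by rw [← φ.ends_onE, Equiv.apply_symm_apply]
  leg_eq := φ.leg_eq
  onV_eq_iff v w := by
    rw [φ.onE.symm.surjective.range_eq, Set.compl_univ, conn_empty, φ.onV.apply_eq_iff_eq]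

/-- The composition of contractions. -/
def comp (q : Contraction H K) (p : Contraction G H) : Contraction G K where
  onV := q.onV ∘ p.onV
  onE := p.onE ∘ q.onE
  onV_surjective := q.onV_surjective.comp p.onV_surjective
  onE_injective := p.onE_injective.comp q.onE_injective
  ends_eq e := by rw [q.ends_eq, p.ends_eq, Sym2.map_map]; rfl
  leg_eq i := by rw [q.leg_eq, p.leg_eq]; rfl
  onV_eq_iff v w := by
    rw [Function.comp_apply, Function.comp_apply, q.onV_eq_iff, p.conn_iff]
    have : (Set.range p.onE)ᶜ ∪ p.onE '' (Set.range q.onE)ᶜ = (Set.range (p.onE ∘ q.onE))ᶜ := by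
      rw [Set.range_comp]
      ext e
      by_cases he : e ∈ Set.range p.onE
      · obtain ⟨f, rfl⟩ := he
        simp [p.onE_injective.eq_iff]
      · have : e ∉ p.onE '' Set.range q.onE := fun ⟨f, _, h⟩ => he ⟨f, h⟩
        simp only [Set.mem_union, Set.mem_compl_iff, he, this, not_false_eq_true, true_or]
    rw [this]

/-- Two contractions of a graph that keep the same edges have isomorphic targets. -/
theorem exists_iso (p : Contraction G H) (q : Contraction G K)
    (h : Set.range p.onE = Set.range q.onE) :
    ∃ φ : Iso H K, ∀ e, q.onE (φ.onE e) = p.onE e := by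
  have hV (v w : G.V) : p.onV v = p.onV w ↔ q.onV v = q.onV w := by
    rw [p.onV_eq_iff, q.onV_eq_iff, h]
  let a := Function.surjInv p.onV_surjective
  let b := Function.surjInv q.onV_surjective
  have ha (v : H.V) : p.onV (a v) = v := Function.surjInv_eq _ v
  have hb (v : K.V) : q.onV (b v) = v := Function.surjInv_eq _ v
  let fV : H.V ≃ K.V :=
    { toFun := fun v => q.onV (a v)
      invFun := fun v => p.onV (b v)
      left_inv := fun v => by
        conv_rhs => rw [← ha v]
        rw [hV, hb]
      right_inv := fun v => by
        conv_rhs => rw [← hb v]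
        rw [← hV, ha] }
  have hfV (v : G.V) : fV (p.onV v) = q.onV v := by
    change q.onV (a (p.onV v)) = _
    rw [← hV, ha]
  let fE : H.E ≃ K.E := (Equiv.ofInjective _ p.onE_injective).trans
    ((Equiv.setCongr h).trans (Equiv.ofInjective _ q.onE_injective).symm)
  have hfE (e : H.E) : q.onE (fE e) = p.onE e := by
    change q.onE ((Equiv.ofInjective _ q.onE_injective).symm _) = _
    exact Equiv.apply_ofInjective_symm q.onE_injective _
  refine ⟨⟨fV, fE, fun e => ?_, fun i => ?_⟩, hfE⟩
  · rw [q.ends_eq, hfE, p.ends_eq, Sym2.map_map]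
    congr 1
    funext v
    exact (hfV v).symm
  · rw [q.leg_eq, p.leg_eq, hfV]

end Contraction

/-! ### Betti numbers -/

theorem card_comps_le_insert (G : LegGraph s) (Z : Set G.E) (e : G.E) :
    Nat.card (G.Comps Z) ≤ Nat.card (G.Comps (insert e Z)) + 1 := by
  classical
  induction hG : G.ends e with
  | _ v w =>
  let P (a : G.V) : Prop := G.conn Z a v ∨ G.conn Z a w
  have hP {a b : G.V} (h : G.conn Z a b) (hb : P b) : P a :=
    hb.imp ((G.conn Z).trans h) ((G.conn Z).trans h)
  let r : Setoid G.V :=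
    { r := fun a b => G.conn Z a b ∨ (P a ∧ P b)
      iseqv :=
        { refl := fun a => Or.inl ((G.conn Z).refl a)
          symm := fun h => h.imp (G.conn Z).symm And.symm
          trans := by
            rintro a b c (h | h) (k | k)
            · exact Or.inl ((G.conn Z).trans h k)
            · exact Or.inr ⟨hP h k.1, k.2⟩
            · exact Or.inr ⟨h.1, hP ((G.conn Z).symm k) h.2⟩
            · exact Or.inr ⟨h.1, k.2⟩ } }
  have hr : G.conn (insert e Z) ≤ r := by
    refine conn_le ?_
    rintro f (rfl | hf) a b hab
    · rw [hG, Sym2.eq_iff] at hab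
      rcases hab with ⟨rfl, rfl⟩ | ⟨rfl, rfl⟩
      · exact Or.inr ⟨Or.inl ((G.conn Z).refl _), Or.inr ((G.conn Z).refl _)⟩
      · exact Or.inr ⟨Or.inr ((G.conn Z).refl _), Or.inl ((G.conn Z).refl _)⟩
    · exact Or.inl (conn_of_mem hf hab)
  let c : G.Comps Z := Quotient.mk (G.conn Z) w
  let m : G.Comps Z → G.Comps (insert e Z) :=
    Quotient.map' (s₁ := G.conn Z) (s₂ := G.conn (insert e Z)) id
      (fun _ _ h => conn_mono (Set.subset_insert e Z) h)
  -- The new edge can only merge the components of `v` and `w`, so the natural map is injective once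
  -- the component of `w` is sent to the extra point.
  let g : G.Comps Z → Option (G.Comps (insert e Z)) := fun q => if q = c then none else some (m q)
  rw [← Finite.card_option]
  refine Nat.card_le_card_of_injective g fun a b hab => ?_
  by_cases ha : a = c <;> by_cases hb : b = c
  · exact ha.trans hb.symm
  · simp [g, ha, hb] at hab
  · simp [g, ha, hb] at hab
  · simp only [g, if_neg ha, if_neg hb, Option.some.injEq] at hab
    obtain ⟨x, rfl⟩ := Quotient.exists_rep a
    obtain ⟨y, rfl⟩ := Quotient.exists_rep b
    have h : G.conn (insert e Z) x y := Quotient.exact hab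
    have hx' : ¬ G.conn Z x w := fun h => ha (Quotient.sound h)
    have hy' : ¬ G.conn Z y w := fun h => hb (Quotient.sound h)
    rcases hr h with h | ⟨h1 | h1, h2 | h2⟩
    · exact Quotient.sound h
    · exact Quotient.sound ((G.conn Z).trans h1 ((G.conn Z).symm h2))
    · exact absurd h2 hy'
    · exact absurd h1 hx'
    · exact absurd h1 hx'

theorem betti_le_insert (G : LegGraph s) (Z : Set G.E) (e : G.E) :
    G.betti Z ≤ G.betti (insert e Z) := by
  by_cases he : e ∈ Z
  · rw [Set.insert_eq_of_mem he]
  · have := G.card_comps_le_insert Z e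
    rw [betti, betti, Set.ncard_insert_of_notMem he]
    push_cast
    lia

theorem betti_mono {G : LegGraph s} {Z W : Set G.E} (h : Z ⊆ W) : G.betti Z ≤ G.betti W := by
  suffices ∀ U : Set G.E, G.betti Z ≤ G.betti (U ∪ Z) by
    simpa [Set.union_eq_left.2 h] using this W
  intro U
  induction U, U.toFinite using Set.Finite.induction_on with
  | empty => simp
  | insert _ _ ih => exact ih.trans (by rw [Set.insert_union]; exact betti_le_insert _ _ _)

theorem betti_empty (G : LegGraph s) : G.betti ∅ = 0 := by
  have : Nat.card (G.Comps ∅) = Nat.card G.V := by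
    symm
    refine Nat.card_congr (Equiv.ofBijective (Quotient.mk (G.conn ∅))
      ⟨fun v w h => conn_empty.1 (Quotient.exact h), Quotient.mk_surjective⟩)
  simp [betti, this]

theorem rank_of_connectedOn {G : LegGraph s} (h : G.ConnectedOn Set.univ) :
    G.rank = (Nat.card G.E : ℤ) - Nat.card G.V + 1 := by
  rw [rank, betti, h, Set.ncard_univ]
  simp

/-- A one-particle irreducible graph with one loop. -/
structure IsCycle (G : LegGraph s) : Prop where
  onePI : G.IsOnePI
  rank_eq : G.rank = 1

/-! ### One-loop graphs: forests, contractions and degrees. -/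

namespace IsCycle

variable {G : LegGraph s}

theorem card_E (hG : G.IsCycle) : Nat.card G.E = Nat.card G.V := by
  have h := hG.rank_eq
  rw [rank_of_connectedOn hG.onePI.1] at h
  lia

theorem nonempty_V (hG : G.IsCycle) : Nonempty G.V := (connectedOn_iff.1 hG.onePI.1).1

theorem nonempty_E (hG : G.IsCycle) : Nonempty G.E := by
  have := hG.nonempty_V
  have h := hG.card_E
  have h' : 0 < Nat.card G.V := Nat.card_pos
  exact (Nat.card_pos_iff.1 (h ▸ h')).1

/-- Removing one edge leaves a connected graph with one edge fewer than vertices, hence Betti number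
0. Monotonicity squeezes every smaller set between this one and the empty set. -/
theorem isForest (hG : G.IsCycle) {Z : Set G.E} (hZ : Z ≠ Set.univ) : G.IsForest Z := by
  obtain ⟨e, he⟩ := (Set.ne_univ_iff_exists_notMem Z).1 hZ
  have h0 : G.betti {e}ᶜ = 0 := by
    have h := hG.onePI.2 e
    have h2 := hG.card_E
    have h3 := Set.ncard_add_ncard_compl {e}
    rw [Set.ncard_singleton] at h3
    rw [betti, h]
    lia
  refine le_antisymm ?_ ?_
  · rw [← h0]
    exact betti_mono (by simpa using he)
  · rw [← G.betti_empty]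
    exact betti_mono (Set.empty_subset Z)

/-- A surviving edge makes the discarded set proper, hence a forest, so edges and vertices drop by
the same number. -/
theorem contraction (hG : G.IsCycle) {H : LegGraph s} (p : Contraction G H) [Nonempty H.E] :
    H.IsCycle := by
  have h1 : H.ConnectedOn Set.univ := by
    rw [p.connectedOn_iff, Set.image_univ, Set.compl_union_self]
    exact hG.onePI.1
  refine ⟨⟨h1, fun e => ?_⟩, ?_⟩
  · rw [p.connectedOn_iff]
    convert hG.onePI.2 (p.onE e) using 1
    ext f
    by_cases hf : f ∈ Set.range p.onE
    · obtain ⟨f, rfl⟩ := hf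
      simp [p.onE_injective.eq_iff]
    · simp only [Set.mem_union, Set.mem_compl_iff, hf, not_false_eq_true, true_or,
        Set.mem_singleton_iff, true_iff]
      rintro rfl
      exact hf ⟨e, rfl⟩
  · rw [rank_of_connectedOn h1, p.card_V]
    have hne : (Set.range p.onE)ᶜ ≠ Set.univ := by
      intro h
      obtain ⟨e⟩ := (inferInstance : Nonempty H.E)
      have : p.onE e ∈ (Set.range p.onE)ᶜ := h ▸ Set.mem_univ _
      exact this ⟨e, rfl⟩
    have hf := hG.isForest hne
    rw [IsForest, betti] at hf
    have h2 := Set.ncard_add_ncard_compl (Set.range p.onE)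
    have h3 : (Set.range p.onE).ncard = Nat.card H.E := by
      rw [← Nat.card_coe_set_eq, Nat.card_congr (Equiv.ofInjective _ p.onE_injective).symm]
    have h4 := hG.card_E
    lia

theorem exists_edge {Z : Set G.E} (h : G.ConnectedOn Z) {v w : G.V} (hw : w ≠ v) :
    ∃ e ∈ Z, ∃ u, u ≠ v ∧ G.ends e = s(v, u) := by
  by_contra! hcon
  -- This relation has the two classes `{v}` and its complement; without an edge leaving `v`,
  -- connectivity would respect it.
  have hr : G.conn Z ≤ Setoid.comap (· = v) ⊥ := by
    refine conn_le fun e he a b hab => ?_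
    change (a = v) = (b = v)
    rw [eq_iff_iff]
    constructor
    · rintro rfl
      by_contra hb
      exact hcon e he b hb hab
    · rintro rfl
      by_contra ha
      exact hcon e he a ha (hab.trans Sym2.eq_swap)
  have h1 : (v = v) = (w = v) := hr ((connectedOn_iff.1 h).2 v w)
  exact hw (h1 ▸ rfl)

theorem two_edges (hG : G.IsCycle) {v w : G.V} (hw : w ≠ v) :
    ∃ e f, e ≠ f ∧ (∃ u, u ≠ v ∧ G.ends e = s(v, u)) ∧ ∃ u, u ≠ v ∧ G.ends f = s(v, u) := by
  obtain ⟨e, -, he⟩ := exists_edge hG.onePI.1 hw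
  obtain ⟨f, hfe, hf⟩ := exists_edge (hG.onePI.2 e) hw
  exact ⟨e, f, fun h => hfe h.symm, he, hf⟩

end IsCycle

/-- The number of half-edges at `v`, not counting legs. -/
noncomputable def edgeDegree (G : LegGraph s) (v : G.V) : ℕ :=
  Nat.card {e : G.E // v ∈ G.ends e} + Nat.card {e : G.E // G.ends e = s(v, v)}

/-- Handshake lemma: exchange the sums and count two half-edges for each edge, a loop being counted
by both terms at its vertex. -/
theorem sum_edgeDegree (G : LegGraph s) [Fintype G.V] :
    ∑ v, G.edgeDegree v = 2 * Nat.card G.E := by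
  classical
  simp only [edgeDegree, Nat.card_eq_fintype_card, Fintype.card_subtype, Finset.card_filter,
    Finset.sum_add_distrib]
  rw [Finset.sum_comm, add_comm, Finset.sum_comm, ← Finset.sum_add_distrib]
  rw [Finset.sum_congr rfl (g := fun _ => 2)]
  · simp [mul_comm]
  · intro e _
    rw [← Finset.card_filter, ← Finset.card_filter]
    induction hG : G.ends e with
    | _ v w =>
    by_cases hvw : v = w
    · subst hvw
      have h1 : (Finset.univ.filter fun u => s(v, v) = s(u, u)) = {v} := by
        ext u; simp [eq_comm]
      have h2 : (Finset.univ.filter fun u => u ∈ s(v, v)) = {v} := by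
        ext u; simp
      rw [h1, h2]; rfl
    · have h1 : (Finset.univ.filter fun u => s(v, w) = s(u, u)) = ∅ := by
        ext u
        simp only [Sym2.eq_iff, Finset.mem_filter, Finset.mem_univ, true_and, Finset.notMem_empty,
          iff_false]
        rintro (⟨rfl, rfl⟩ | ⟨rfl, rfl⟩) <;> exact hvw rfl
      have h2 : (Finset.univ.filter fun u => u ∈ s(v, w)) = {v, w} := by
        ext u; simp
      rw [h1, h2, Finset.card_pair hvw]; rfl

namespace IsCycle

variable {G : LegGraph s}

theorem two_le_edgeDegree (hG : G.IsCycle) (v : G.V) : 2 ≤ G.edgeDegree v := by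
  classical
  by_cases hv : ∃ e, G.ends e = s(v, v)
  · obtain ⟨e, he⟩ := hv
    have h1 : 0 < Nat.card {e : G.E // v ∈ G.ends e} :=
      Nat.card_pos_iff.2 ⟨⟨e, by simp [he]⟩, inferInstance⟩
    have h2 : 0 < Nat.card {e : G.E // G.ends e = s(v, v)} :=
      Nat.card_pos_iff.2 ⟨⟨e, he⟩, inferInstance⟩
    unfold edgeDegree
    lia
  · obtain ⟨e⟩ := hG.nonempty_E
    have hw : ∃ w, w ≠ v := by
      by_contra! h
      refine hv ⟨e, ?_⟩
      induction hG : G.ends e with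
      | _ a b => rw [h a, h b]
    obtain ⟨w, hw⟩ := hw
    obtain ⟨e, f, hef, ⟨u, -, hu⟩, ⟨u', -, hu'⟩⟩ := hG.two_edges hw
    have : 1 < Nat.card {e : G.E // v ∈ G.ends e} := by
      rw [Finite.one_lt_card_iff_nontrivial]
      exact ⟨⟨e, by simp [hu]⟩, ⟨f, by simp [hu']⟩, fun h => hef (congrArg Subtype.val h)⟩
    unfold edgeDegree
    lia

/-- The degrees are at least 2 and sum to twice the number of vertices, so none can exceed 2. -/
theorem edgeDegree_eq (hG : G.IsCycle) (v : G.V) : G.edgeDegree v = 2 := by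
  have := Fintype.ofFinite G.V
  have h := G.sum_edgeDegree
  rw [hG.card_E, Nat.card_eq_fintype_card] at h
  by_contra hv
  have h2 : ∑ _v : G.V, 2 < ∑ v, G.edgeDegree v :=
    Finset.sum_lt_sum (fun v _ => hG.two_le_edgeDegree v)
      ⟨v, Finset.mem_univ v, lt_of_le_of_ne (hG.two_le_edgeDegree v) (Ne.symm hv)⟩
  simp at h2
  lia

theorem isAdmissible_iff (hG : G.IsCycle) : G.IsAdmissible ↔ Function.Surjective G.leg := by
  have h (v : G.V) : 3 ≤ G.valency v ↔ ∃ i, G.leg i = v := by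
    have h1 := hG.edgeDegree_eq v
    have h2 : 0 < Nat.card {i : Fin s // G.leg i = v} ↔ ∃ i, G.leg i = v := by
      rw [Nat.card_pos_iff]
      simp
      intros; infer_instance
    rw [← h2]
    unfold valency
    unfold edgeDegree at h1
    lia
  exact ⟨fun ha v => (h v).1 (ha.2 v), fun hs => ⟨hG.onePI, fun v => (h v).2 (hs v)⟩⟩

theorem no_loop (hG : G.IsCycle) {v w : G.V} (hw : w ≠ v) (e : G.E) : G.ends e ≠ s(v, v) := by
  intro he
  obtain ⟨f, g, hfg, ⟨u, hu, hf⟩, ⟨u', hu', hg⟩⟩ := hG.two_edges hw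
  have h1 : 0 < Nat.card {e : G.E // G.ends e = s(v, v)} :=
    Nat.card_pos_iff.2 ⟨⟨e, he⟩, inferInstance⟩
  have h2 : 1 < Nat.card {e : G.E // v ∈ G.ends e} := by
    rw [Finite.one_lt_card_iff_nontrivial]
    exact ⟨⟨f, by simp [hf]⟩, ⟨g, by simp [hg]⟩, fun h => hfg (congrArg Subtype.val h)⟩
  have h3 := hG.edgeDegree_eq v
  unfold edgeDegree at h3
  lia

theorem card_edges_at (hG : G.IsCycle) {v w : G.V} (hw : w ≠ v) :
    Nat.card {e : G.E // v ∈ G.ends e} = 2 := by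
  have h := hG.edgeDegree_eq v
  have : IsEmpty {e : G.E // G.ends e = s(v, v)} := ⟨fun e => hG.no_loop hw e.1 e.2⟩
  rwa [edgeDegree, Nat.card_of_isEmpty (α := {e : G.E // G.ends e = s(v, v)}), add_zero] at h

end IsCycle

end LegGraph

/-- A product of two involutions without fixed points on an orbit never reverses a point. -/
theorem Equiv.Perm.zpow_mul_apply_ne {X : Type*} {ρ τ : Equiv.Perm X} (hρ : ρ * ρ = 1)
    (hτ : τ * τ = 1) (hρ' : ∀ x, ρ x ≠ x) (hτ' : ∀ x, τ x ≠ x) (x : X) (i j : ℤ) :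
    ((τ * ρ) ^ j) x ≠ ρ (((τ * ρ) ^ i) x) := by
  have hρi : ρ⁻¹ = ρ := inv_eq_of_mul_eq_one_left hρ
  have hτi : τ⁻¹ = τ := inv_eq_of_mul_eq_one_left hτ
  -- Dihedral relation: conjugation by `ρ` inverts the rotation `τ * ρ`.
  have hconj (n : ℤ) : ρ * (τ * ρ) ^ n = (τ * ρ) ^ (-n) * ρ := by
    have h1 : ρ * (τ * ρ) * ρ⁻¹ = (τ * ρ)⁻¹ := by
      rw [mul_inv_rev, hρi, hτi, mul_assoc, mul_assoc, hρ, mul_one]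
    rw [zpow_neg, ← inv_zpow, ← h1, conj_zpow, inv_mul_cancel_right]
  have hap (n : ℤ) (y : X) : ρ (((τ * ρ) ^ n) y) = ((τ * ρ) ^ (-n)) (ρ y) := by
    rw [← Equiv.Perm.mul_apply, hconj, Equiv.Perm.mul_apply]
  intro h
  rw [hap] at h
  have h2 : ((τ * ρ) ^ (i + j)) x = ρ x := by
    rw [zpow_add, Equiv.Perm.mul_apply, h, ← Equiv.Perm.mul_apply, ← zpow_add]
    simp
  -- A reflection of the orbit has a midpoint: for an even sum `ρ` fixes a point, for an odd sum `τ`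
  -- does.
  rcases Int.even_or_odd' (i + j) with ⟨m, hm | hm⟩
  · apply hρ' (((τ * ρ) ^ m) x)
    rw [hap, ← h2, hm, ← Equiv.Perm.mul_apply, ← zpow_add]
    congr 2; ring
  · have h3 : τ (ρ (((τ * ρ) ^ m) x)) = ((τ * ρ) ^ (1 + m)) x := by
      rw [zpow_add, zpow_one]; rfl
    have h4 : ρ (((τ * ρ) ^ m) x) = ((τ * ρ) ^ (1 + m)) x := by
      rw [hap, ← h2, hm, ← Equiv.Perm.mul_apply, ← zpow_add]
      congr 2; ring
    exact hτ' _ (h3.trans h4.symm)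

/-! ### Cyclic numberings and flags. -/

namespace LegGraph

variable {s : ℕ}

/-- Cyclic numberings of the vertices and of the edges of a graph. -/
structure CycleFrame (k : ℕ) (G : LegGraph s) where
  onV : ZMod k ≃ G.V
  onE : ZMod k ≃ G.E
  ends_onE : ∀ i, G.ends (onE i) = s(onV i, onV (i + 1))

/-- The pairs of an edge and one of its ends. -/
def Flag (G : LegGraph s) : Type := {p : G.V × G.E // p.1 ∈ G.ends p.2}

instance (G : LegGraph s) : Finite G.Flag :=
  inferInstanceAs (Finite {p : G.V × G.E // p.1 ∈ G.ends p.2})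

namespace CycleFrame

variable {k : ℕ} {G : LegGraph s}

/-- The flag at the origin of a cyclic numbering. -/
def flag (F : CycleFrame k G) : G.Flag := ⟨(F.onV 0, F.onE 0), by rw [F.ends_onE]; simp⟩

theorem mem_ends_iff (F : CycleFrame k G) (i j : ZMod k) :
    F.onV i ∈ G.ends (F.onE j) ↔ i = j ∨ i = j + 1 := by
  simp [F.ends_onE]

/-- The starting flag determines the whole walk: the current edge gives the next vertex, and that
vertex gives the next edge. -/
theorem flag_injective [NeZero k] : Function.Injective (flag : CycleFrame k G → G.Flag) := by
  intro F F' h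
  have h0 : F.onV 0 = F'.onV 0 ∧ F.onE 0 = F'.onE 0 := by
    simpa [flag] using congrArg Subtype.val h
  have key (n : ℕ) : F.onV n = F'.onV n ∧ F.onE n = F'.onE n := by
    induction n with
    | zero => simpa using h0
    | succ n ih =>
      obtain ⟨h1, h2⟩ := ih
      have hV : F.onV (n + 1) = F'.onV (n + 1) := by
        have h3 := F.ends_onE n
        rw [h2, F'.ends_onE, h1] at h3
        exact (Sym2.congr_right.1 h3).symm
      rw [Nat.cast_add_one]
      refine ⟨hV, ?_⟩
      obtain ⟨j, hj⟩ := F.onE.surjective (F'.onE (n + 1))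
      have h4 : F.onV (n + 1) ∈ G.ends (F.onE j) := by
        rw [hj, hV, F'.mem_ends_iff]
        exact Or.inl rfl
      rcases (F.mem_ends_iff _ _).1 h4 with h5 | h5
      · rw [h5, hj, ← h5]
      -- Turning back onto the same edge is possible only if `n = n + 1` in `ZMod k`, that is, for a
      -- single loop.
      · have h5 : (n : ZMod k) = j := add_right_cancel h5
        have h6 : F'.onE n = F'.onE (n + 1) := by rw [← h2, ← hj, h5]
        rw [← F'.onE.injective h6]
        exact h2
  have hkey (i : ZMod k) : F.onV i = F'.onV i ∧ F.onE i = F'.onE i := by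
    rw [← ZMod.natCast_zmod_val i]
    exact key i.val
  cases F; cases F'
  simp only [mk.injEq]
  exact ⟨Equiv.ext fun i => (hkey i).1, Equiv.ext fun i => (hkey i).2⟩

end CycleFrame

namespace Flag

variable {G : LegGraph s}

/-- The flag at the other end of the same edge. -/
noncomputable def rev (x : G.Flag) : G.Flag :=
  ⟨(Sym2.Mem.other x.2, x.1.2), Sym2.other_mem x.2⟩

theorem ends_eq (x : G.Flag) : G.ends x.1.2 = s(x.1.1, x.rev.1.1) :=
  (Sym2.other_spec x.2).symm

theorem rev_rev (x : G.Flag) : x.rev.rev = x := by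
  refine Subtype.ext (Prod.ext ?_ rfl)
  have h1 := x.rev.ends_eq
  have h2 := x.ends_eq
  change G.ends x.1.2 = _ at h1
  rw [h2, Sym2.eq_swap] at h1
  exact (Sym2.congr_right.1 h1).symm

end Flag

namespace IsCycle

variable {G : LegGraph s}

theorem flag_surjective_of_subsingleton (hG : G.IsCycle) (h : Nat.card G.V = 1) :
    Function.Surjective (CycleFrame.flag : CycleFrame 1 G → G.Flag) := by
  have hV := (Nat.card_eq_one_iff_unique.1 h).1
  have hE := (Nat.card_eq_one_iff_unique.1 (hG.card_E.trans h)).1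
  intro x
  refine ⟨⟨@Equiv.ofUnique _ _ (inferInstanceAs (Unique (Fin 1))) ⟨⟨x.1.1⟩, fun _ => Subsingleton.elim _ _⟩,
    @Equiv.ofUnique _ _ (inferInstanceAs (Unique (Fin 1))) ⟨⟨x.1.2⟩, fun _ => Subsingleton.elim _ _⟩,
    fun i => ?_⟩, ?_⟩
  · have (z : Sym2 G.V) (v w) : z = s(v, w) := by
      induction z with
      | _ a b => rw [Subsingleton.elim a v, Subsingleton.elim b w]
    exact this _ _ _
  · exact Subtype.ext (Prod.ext (Subsingleton.elim _ _) (Subsingleton.elim _ _))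

theorem existsUnique_turn (hG : G.IsCycle) [Nontrivial G.V] (x : G.Flag) :
    ∃! y : G.Flag, y.1.1 = x.1.1 ∧ y ≠ x := by
  obtain ⟨w, hw⟩ := exists_ne x.1.1
  have h := hG.card_edges_at hw
  rw [Nat.card_eq_two_iff' (⟨x.1.2, x.2⟩ : {e : G.E // x.1.1 ∈ G.ends e})] at h
  obtain ⟨⟨e, he⟩, h1, h2⟩ := h
  refine ⟨⟨(x.1.1, e), he⟩, ⟨rfl, fun h => h1 (Subtype.ext (congrArg (fun y => y.1.2) h))⟩, ?_⟩
  rintro ⟨⟨v, f⟩, hf⟩ ⟨rfl, hne⟩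
  have h3 := h2 ⟨f, hf⟩ (fun h => hne (Subtype.ext (Prod.ext rfl (congrArg Subtype.val h))))
  exact Subtype.ext (Prod.ext rfl (congrArg Subtype.val h3))

/-- Walk from the given flag by alternately crossing the edge (`ρ`) and turning to the other edge at
the vertex (`τ`). The walk never meets the reverse of one of its flags, so it repeats a vertex or an
edge only after a full period. By connectedness it reaches every vertex. -/
theorem flag_surjective_of_nontrivial (hG : G.IsCycle) [Nontrivial G.V] :
    Function.Surjective (CycleFrame.flag : CycleFrame (Nat.card G.V) G → G.Flag) := by
  choose t ht htu using hG.existsUnique_turn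
  have htt (x : G.Flag) : t (t x) = x :=
    (htu (t x) x ⟨(ht x).1.symm, (ht x).2.symm⟩).symm
  let ρ : Equiv.Perm G.Flag := ⟨Flag.rev, Flag.rev, Flag.rev_rev, Flag.rev_rev⟩
  let τ : Equiv.Perm G.Flag := ⟨t, t, htt, htt⟩
  have hρ : ρ * ρ = 1 := Equiv.ext Flag.rev_rev
  have hτ : τ * τ = 1 := Equiv.ext htt
  have hρ' (x : G.Flag) : ρ x ≠ x := by
    intro h
    obtain ⟨w, hw⟩ := exists_ne x.1.1
    refine hG.no_loop hw x.1.2 ?_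
    have := x.ends_eq
    rwa [show x.rev = x from h] at this
  have hτ' (x : G.Flag) : τ x ≠ x := (ht x).2
  have hne := Equiv.Perm.zpow_mul_apply_ne hρ hτ hρ' hτ'
  intro x
  let F : ℤ → G.Flag := fun i => ((τ * ρ) ^ i) x
  have hF (i : ℤ) : F (i + 1) = τ (ρ (F i)) := by
    simp only [F]
    rw [add_comm, zpow_add, zpow_one]; rfl
  have hne' (i j : ℤ) : F j ≠ ρ (F i) := hne x i j
  let p := Function.minimalPeriod (τ * ρ) x
  have hp : 0 < p := Function.minimalPeriod_pos_of_mem_periodicPts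
    (Function.mem_periodicPts.2 ⟨orderOf (τ * ρ), orderOf_pos _, by
      rw [Function.IsPeriodicPt, Function.IsFixedPt, Equiv.Perm.iterate_eq_pow, pow_orderOf_eq_one]
      rfl⟩)
  have hFp (i j : ℤ) : F i = F j ↔ (i : ZMod p) = (j : ZMod p) := by
    have h1 : F i = F j ↔ ((τ * ρ) ^ (j - i)) x = x := by
      rw [sub_eq_neg_add, zpow_add, Equiv.Perm.mul_apply, zpow_neg, Equiv.Perm.inv_eq_iff_eq, eq_comm]
    rw [h1, ZMod.intCast_eq_intCast_iff_dvd_sub]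
    exact MulAction.zpow_smul_eq_iff_minimalPeriod_dvd (a := τ * ρ) (b := x)
  have hV (i j : ℤ) : (F i).1.1 = (F j).1.1 ↔ F i = F j := by
    refine ⟨fun h => ?_, fun h => h ▸ rfl⟩
    by_contra hij
    have h1 : F i = τ (F j) := htu _ _ ⟨h, hij⟩
    have h2 := hF (j - 1)
    rw [sub_add_cancel] at h2
    rw [h2] at h1
    exact hne' _ _ (h1.trans (htt _))
  have hE (i j : ℤ) : (F i).1.2 = (F j).1.2 ↔ F i = F j := by
    refine ⟨fun h => ?_, fun h => h ▸ rfl⟩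
    by_contra hij
    have h1 := (F i).ends_eq
    have h2 := (F j).2
    rw [← h, h1, Sym2.mem_iff] at h2
    rcases h2 with h2 | h2
    · exact hij (Subtype.ext (Prod.ext h2.symm h))
    · exact hne' i j (Subtype.ext (Prod.ext h2 h.symm))
  have hends (i : ℤ) : G.ends (F i).1.2 = s((F i).1.1, (F (i + 1)).1.1) := by
    rw [(F i).ends_eq, hF]
    exact congrArg (fun v => s((F i).1.1, v)) (ht (F i).rev).1.symm
  have hsurj (v : G.V) : ∃ i, (F i).1.1 = v := by
    have hr : G.conn Set.univ ≤ Setoid.comap (fun v => ∃ i, (F i).1.1 = v) ⊥ := by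
      have hstep (e) (a b : G.V) (hab : G.ends e = s(a, b)) (ha : ∃ i, (F i).1.1 = a) :
          ∃ i, (F i).1.1 = b := by
        obtain ⟨i, rfl⟩ := ha
        have he : (F i).1.1 ∈ G.ends e := by rw [hab]; simp
        by_cases hei : e = (F i).1.2
        · rw [hei, hends] at hab
          exact ⟨i + 1, Sym2.congr_right.1 hab⟩
        · have h1 : (⟨((F i).1.1, e), he⟩ : G.Flag) = τ (F i) :=
            htu _ _ ⟨rfl, fun h => hei (congrArg (fun y => y.1.2) h)⟩
          have h2 := hF (i - 1)
          rw [sub_add_cancel] at h2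
          have h3 : e = (F (i - 1)).1.2 :=
            congrArg (fun y => y.1.2) (h1.trans ((congrArg τ h2).trans (htt _)))
          rw [h3, hends, sub_add_cancel, Sym2.eq_swap] at hab
          exact ⟨i - 1, Sym2.congr_right.1 hab⟩
      refine conn_le fun e _ a b hab => ?_
      change (∃ i, (F i).1.1 = a) = (∃ i, (F i).1.1 = b)
      exact propext ⟨hstep e a b hab, hstep e b a (hab.trans Sym2.eq_swap)⟩
    have h1 : (∃ i, (F i).1.1 = x.1.1) = (∃ i, (F i).1.1 = v) :=
      hr ((connectedOn_iff.1 hG.onePI.1).2 x.1.1 v)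
    exact h1 ▸ ⟨0, rfl⟩
  have hcast (i : ZMod p) : (((i.cast : ℤ)) : ZMod p) = i := ZMod.intCast_zmod_cast i
  have hbV : Function.Bijective fun i : ZMod p => (F i.cast).1.1 := by
    refine ⟨fun i j h => ?_, fun v => ?_⟩
    · rwa [hV, hFp, hcast, hcast] at h
    · obtain ⟨i, rfl⟩ := hsurj v
      exact ⟨i, by rw [hV, hFp, hcast]⟩
  have hpV : p = Nat.card G.V := by
    rw [← Nat.card_congr (Equiv.ofBijective _ hbV), Nat.card_zmod]
  -- Injectivity suffices, because there are as many edges as vertices.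
  have hbE : Function.Bijective fun i : ZMod p => (F i.cast).1.2 := by
    have : NeZero p := ⟨hp.ne'⟩
    have := Fintype.ofFinite G.E
    rw [Fintype.bijective_iff_injective_and_card]
    refine ⟨fun i j h => ?_, ?_⟩
    · rwa [hE, hFp, hcast, hcast] at h
    · rw [ZMod.card, hpV, ← hG.card_E, Nat.card_eq_fintype_card]
  rw [← hpV]
  have h0 : F ((0 : ZMod p).cast : ℤ) = x := by
    rw [ZMod.cast_zero]; rfl
  refine ⟨⟨Equiv.ofBijective _ hbV, Equiv.ofBijective _ hbE, fun i => ?_⟩, ?_⟩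
  · change G.ends (F i.cast).1.2 = s((F i.cast).1.1, (F (i + 1).cast).1.1)
    have h1 : F (i.cast + 1) = F (i + 1).cast := by
      rw [hFp, Int.cast_add, hcast, hcast, Int.cast_one]
    rw [hends, h1]
  · exact Subtype.ext (Prod.ext (congrArg (fun y => y.1.1) h0) (congrArg (fun y => y.1.2) h0))

theorem flag_bijective (hG : G.IsCycle) {k : ℕ} (hk : Nat.card G.E = k) :
    Function.Bijective (CycleFrame.flag : CycleFrame k G → G.Flag) := by
  have := hG.nonempty_V
  rw [hG.card_E] at hk
  subst hk
  have : NeZero (Nat.card G.V) := ⟨Nat.card_pos.ne'⟩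
  refine ⟨CycleFrame.flag_injective, ?_⟩
  rcases subsingleton_or_nontrivial G.V with h | h
  · have h1 : Nat.card G.V = 1 := Nat.card_eq_one_iff_unique.2 ⟨h, hG.nonempty_V⟩
    have := hG.flag_surjective_of_subsingleton h1
    rwa [← h1] at this
  · exact hG.flag_surjective_of_nontrivial

/-- A flag does not distinguish the two halves of a loop, hence the exceptional value for `k = 1`.
-/
theorem card_flag (hG : G.IsCycle) {k : ℕ} (hk : Nat.card G.E = k) :
    Nat.card G.Flag = k * if k = 1 then 1 else 2 := by
  have := hG.nonempty_V
  rw [hG.card_E] at hk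
  let e : G.Flag ≃ Σ v : G.V, {e : G.E // v ∈ G.ends e} :=
    { toFun := fun x => ⟨x.1.1, x.1.2, x.2⟩
      invFun := fun x => ⟨(x.1, x.2.1), x.2.2⟩
      left_inv := fun _ => rfl
      right_inv := fun _ => rfl }
  have := Fintype.ofFinite G.V
  rw [Nat.card_congr e, Nat.card_sigma]
  rcases subsingleton_or_nontrivial G.V with h | h
  · have h1 : Nat.card G.V = 1 := Nat.card_eq_one_iff_unique.2 ⟨h, hG.nonempty_V⟩
    have hE := Nat.card_eq_one_iff_unique.1 (hG.card_E.trans h1)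
    have h2 (v : G.V) : Nat.card {e : G.E // v ∈ G.ends e} = 1 := by
      have := hE.1
      obtain ⟨e⟩ := hE.2
      refine Nat.card_eq_one_iff_unique.2 ⟨inferInstance, ⟨e, ?_⟩⟩
      induction he : G.ends e with
      | _ a b => simp [Subsingleton.elim v a]
    rw [Finset.sum_congr rfl fun v _ => h2 v, Finset.sum_const, Finset.card_univ,
      Fintype.card_eq_nat_card, hk, ← hk, h1]
    rfl
  · have h1 : k ≠ 1 := by
      rw [← hk]
      exact (Finite.one_lt_card_iff_nontrivial.2 h).ne'
    have h2 (v : G.V) : Nat.card {e : G.E // v ∈ G.ends e} = 2 :=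
      hG.card_edges_at (exists_ne v).choose_spec
    rw [Finset.sum_congr rfl fun v _ => h2 v, Finset.sum_const, Finset.card_univ,
      Fintype.card_eq_nat_card, hk, if_neg h1, smul_eq_mul]

theorem card_cycleFrame (hG : G.IsCycle) {k : ℕ} (hk : Nat.card G.E = k) :
    Nat.card (CycleFrame k G) = k * if k = 1 then 1 else 2 := by
  rw [Nat.card_congr (Equiv.ofBijective _ (hG.flag_bijective hk)), hG.card_flag hk]

end IsCycle

end LegGraph

/-! ### Extending metrics by zero along injections. -/

namespace stdSimplex

variable {X Y : Type*} [Fintype X] [Fintype Y]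

theorem map_apply_of_injective {f : X → Y} (hf : Function.Injective f) (t : stdSimplex ℝ X)
    (x : X) : stdSimplex.map f t (f x) = t x := by
  classical
  rw [stdSimplex.map_coe, FunOnFinite.linearMap_apply_apply, Finset.sum_eq_single x]
  · intro y hy hyx
    exact absurd (hf (Finset.mem_filter.1 hy).2) hyx
  · intro hx
    simp at hx

theorem map_apply_of_notMem_range {f : X → Y} (t : stdSimplex ℝ X) {y : Y}
    (hy : y ∉ Set.range f) : stdSimplex.map f t y = 0 := by
  classical
  rw [stdSimplex.map_coe, FunOnFinite.linearMap_apply_apply, Finset.sum_eq_zero]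
  intro x hx
  exact absurd ⟨x, (Finset.mem_filter.1 hx).2⟩ hy

theorem exists_map_eq {f : X → Y} (hf : Function.Injective f) (l : stdSimplex ℝ Y)
    (h : ∀ y ∉ Set.range f, l y = 0) :
    ∃ t : stdSimplex ℝ X, stdSimplex.map f t = l ∧ ∀ x, t x = l (f x) := by
  classical
  have hsum : ∑ x, l (f x) = 1 := by
    rw [← stdSimplex.sum_eq_one l, ← Finset.sum_image (s := Finset.univ) (g := f) (f := fun y => l y)
      hf.injOn]
    refine Finset.sum_subset (Finset.subset_univ _) fun y _ hy => h y ?_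
    simpa using hy
  let t : stdSimplex ℝ X := ⟨fun x => l (f x), fun x => stdSimplex.zero_le l _, hsum⟩
  refine ⟨t, stdSimplex.ext (funext fun y => ?_), fun x => rfl⟩
  by_cases hy : y ∈ Set.range f
  · obtain ⟨x, rfl⟩ := hy
    rw [map_apply_of_injective hf]
    rfl
  · rw [map_apply_of_notMem_range t hy, h y hy]

end stdSimplex

namespace LegGraph

variable {s : ℕ}

theorem exists_iso_of_contract_empty (G : LegGraph s) {Z : Set G.E} (hZ : Z = ∅) :
    ∃ φ : Iso (G.contract Z) G, ∀ e, φ.onE e = e.1 := by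
  refine (Contraction.ofSet G Z).exists_iso (Contraction.ofIso (Iso.refl G)) ?_
  rw [Contraction.range_ofSet, hZ, Set.compl_empty]
  exact (Equiv.refl G.E).symm.surjective.range_eq.symm

end LegGraph

/-! ### Colored graphs, their simplices and the Δ-complex. -/

namespace HoloGraph

variable {s : ℕ}

theorem isCycle (Γ : HoloGraph 1 s) : Γ.toLegGraph.IsCycle :=
  ⟨Γ.admissible.1, by simpa using Γ.rank_eq⟩

theorem leg_surjective (Γ : HoloGraph 1 s) : Function.Surjective Γ.leg :=
  Γ.isCycle.isAdmissible_iff.1 Γ.admissible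

/-- Volume one leaves some edge of positive length. So in rank one no face of a simplex is missing.
-/
theorem isForest_zero (Γ : HoloGraph 1 s) (l : stdSimplex ℝ Γ.E) : Γ.IsForest {e | l e = 0} := by
  refine Γ.isCycle.isForest fun h => ?_
  have h1 := stdSimplex.sum_eq_one l
  rw [Finset.sum_eq_zero fun e _ => (h ▸ Set.mem_univ e : e ∈ {e | l e = 0})] at h1
  exact zero_ne_one h1

/-- The point of the moduli space given by a metric on a colored graph. -/
def point (Γ : HoloGraph 1 s) (l : stdSimplex ℝ Γ.E) : MHG 1 s :=
  MHG.mk ⟨Γ, l, Γ.isForest_zero l⟩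

theorem exists_point (x : MHG 1 s) : ∃ (Γ : HoloGraph 1 s) (l : stdSimplex ℝ Γ.E), Γ.point l = x := by
  obtain ⟨⟨Γ, l, h⟩, rfl⟩ := Quotient.exists_rep x
  exact ⟨Γ, l, rfl⟩

theorem continuous_point (Γ : HoloGraph 1 s) : Continuous Γ.point := by
  have h1 : Continuous (MetricHoloGraph.mk Γ) :=
    continuous_iff_coinduced_le.2
      (le_iSup (fun Γ : HoloGraph 1 s => TopologicalSpace.coinduced (MetricHoloGraph.mk Γ)
        inferInstance) Γ)
  exact continuous_quotient_mk'.comp (h1.comp (continuous_id.subtype_mk Γ.isForest_zero))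

theorem isOpen_iff (A : Set (MHG 1 s)) :
    IsOpen A ↔ ∀ Γ : HoloGraph 1 s, IsOpen (Γ.point ⁻¹' A) := by
  refine ⟨fun h Γ => h.preimage Γ.continuous_point, fun h => ?_⟩
  change IsOpen (MHG.mk ⁻¹' A)
  refine isOpen_iSup_iff.2 fun Γ => isOpen_coinduced.2 ?_
  exact (h Γ).preimage continuous_subtype_val

/-- A contraction of colored graphs. -/
structure Contraction (Γ Γ' : HoloGraph 1 s) extends
    LegGraph.Contraction Γ.toLegGraph Γ'.toLegGraph where
  color_onE : ∀ e, Γ.color (onE e) = Γ'.color e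

/-- Discarded edges get length zero, so both metric graphs collapse to quotients of `Γ` keeping the
same edges, and `exists_iso` applies. -/
theorem point_map {Γ Γ' : HoloGraph 1 s} (p : Contraction Γ Γ') (l : stdSimplex ℝ Γ'.E) :
    Γ.point (stdSimplex.map p.onE l) = Γ'.point l := by
  refine Quotient.sound ?_
  let x : MetricHoloGraph 1 s := ⟨Γ, _, Γ.isForest_zero (stdSimplex.map p.onE l)⟩
  let y : MetricHoloGraph 1 s := ⟨Γ', _, Γ'.isForest_zero l⟩
  change ∃ φ : LegGraph.Iso (x.graph.contract x.zeroSet) (y.graph.contract y.zeroSet), _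
  obtain ⟨φ, hφ⟩ := (LegGraph.Contraction.ofSet Γ.toLegGraph x.zeroSet).exists_iso
    ((LegGraph.Contraction.ofSet Γ'.toLegGraph y.zeroSet).comp p.toContraction) (by
      change _ = Set.range (p.onE ∘ _)
      rw [Set.range_comp, LegGraph.Contraction.range_ofSet, LegGraph.Contraction.range_ofSet]
      ext e
      simp only [Set.mem_image, Set.mem_compl_iff, MetricHoloGraph.zeroSet]
      by_cases he : e ∈ Set.range p.onE
      · obtain ⟨f, rfl⟩ := he
        change ¬ stdSimplex.map p.onE l (p.onE f) = 0 ↔ _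
        rw [stdSimplex.map_apply_of_injective p.onE_injective]
        exact ⟨fun h => ⟨f, h, rfl⟩, fun ⟨g, hg, h⟩ => p.onE_injective h ▸ hg⟩
      · refine iff_of_false (not_not.2 (stdSimplex.map_apply_of_notMem_range l he)) ?_
        rintro ⟨f, -, h⟩
        exact he ⟨f, h⟩)
  refine ⟨φ, fun e => ?_⟩
  have he : p.onE (φ.onE e).1 = e.1 := hφ e
  refine ⟨?_, ?_⟩
  · exact (p.color_onE _).symm.trans (congrArg Γ.color he)
  · exact (stdSimplex.map_apply_of_injective p.onE_injective l _).symm.trans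
      (congrArg (stdSimplex.map p.onE l) he)

/-- Isomorphism of colored graphs. -/
def IsIso (Γ Γ' : HoloGraph 1 s) : Prop :=
  ∃ φ : LegGraph.Iso Γ.toLegGraph Γ'.toLegGraph, ∀ e, Γ'.color (φ.onE e) = Γ.color e

theorem IsIso.symm {Γ Γ' : HoloGraph 1 s} (h : IsIso Γ Γ') : IsIso Γ' Γ := by
  obtain ⟨φ, h⟩ := h
  refine ⟨φ.symm, fun e => ?_⟩
  rw [← h]
  exact congrArg Γ'.color (φ.onE.apply_symm_apply e)

theorem IsIso.trans {Γ Γ' Γ'' : HoloGraph 1 s} (h : IsIso Γ Γ') (h' : IsIso Γ' Γ'') :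
    IsIso Γ Γ'' := by
  obtain ⟨φ, h⟩ := h
  obtain ⟨ψ, h'⟩ := h'
  exact ⟨φ.trans ψ, fun e => (h' _).trans (h e)⟩

theorem IsIso.card_eq {Γ Γ' : HoloGraph 1 s} (h : IsIso Γ Γ') : Nat.card Γ.E = Nat.card Γ'.E := by
  obtain ⟨φ, -⟩ := h
  exact Nat.card_congr φ.onE

theorem isIso_of_point_eq {Γ Γ' : HoloGraph 1 s} {l : stdSimplex ℝ Γ.E} {l' : stdSimplex ℝ Γ'.E}
    (hl : ∀ e, 0 < l e) (hl' : ∀ e, 0 < l' e) (h : Γ.point l = Γ'.point l') :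
    ∃ φ : LegGraph.Iso Γ.toLegGraph Γ'.toLegGraph,
      ∀ e, Γ'.color (φ.onE e) = Γ.color e ∧ l' (φ.onE e) = l e := by
  obtain ⟨ψ, hψ⟩ := Quotient.exact h
  obtain ⟨α, hα⟩ := Γ.exists_iso_of_contract_empty
    (Z := MetricHoloGraph.zeroSet ⟨Γ, _, Γ.isForest_zero l⟩)
    (Set.eq_empty_of_forall_notMem fun e he => (hl e).ne' he)
  obtain ⟨β, hβ⟩ := Γ'.exists_iso_of_contract_empty
    (Z := MetricHoloGraph.zeroSet ⟨Γ', _, Γ'.isForest_zero l'⟩)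
    (Set.eq_empty_of_forall_notMem fun e he => (hl' e).ne' he)
  refine ⟨α.symm.trans (ψ.trans β), fun e => ?_⟩
  have h1 : ((α.symm.trans (ψ.trans β)).onE e) = (ψ.onE (α.symm.onE e)).1 := hβ _
  have h2 : (α.symm.onE e).1 = e := (hα _).symm.trans (α.onE.apply_symm_apply e)
  have h3 := hψ (α.symm.onE e)
  rw [h1]
  exact ⟨h3.1.trans (congrArg Γ.color h2), h3.2.trans (congrArg l h2)⟩

/-- The colored graph obtained by collapsing a proper subset of the edges. -/
def contract (Γ : HoloGraph 1 s) (Z : Set Γ.E) (hZ : Z ≠ Set.univ) : HoloGraph 1 s :=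
  have hc : (Γ.toLegGraph.contract Z).IsCycle := by
    obtain ⟨e, he⟩ := (Set.ne_univ_iff_exists_notMem Z).1 hZ
    have : Nonempty (Γ.toLegGraph.contract Z).E := ⟨⟨e, he⟩⟩
    exact Γ.isCycle.contraction (LegGraph.Contraction.ofSet _ Z)
  { toLegGraph := Γ.toLegGraph.contract Z
    admissible := hc.isAdmissible_iff.2 (Quotient.mk_surjective.comp Γ.leg_surjective)
    rank_eq := hc.rank_eq
    color := fun e => Γ.color e.1
    color_injective := Γ.color_injective.comp Subtype.val_injective }

theorem exists_contraction (Γ : HoloGraph 1 s) {Z : Set Γ.E} (hZ : Z ≠ Set.univ)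
    {Γ' : HoloGraph 1 s} (h : IsIso (Γ.contract Z hZ) Γ') :
    ∃ p : Contraction Γ Γ', Set.range p.onE = Zᶜ := by
  obtain ⟨φ, hφ⟩ := h
  refine ⟨⟨(LegGraph.Contraction.ofIso φ).comp (LegGraph.Contraction.ofSet _ Z), fun e => ?_⟩, ?_⟩
  · rw [← φ.onE.apply_symm_apply e, hφ]
    change Γ.color (φ.onE.symm (φ.onE (φ.onE.symm e))).1 = Γ.color (φ.onE.symm e).1
    rw [Equiv.symm_apply_apply]
  · exact (φ.onE.symm.surjective.range_comp _).trans (LegGraph.Contraction.range_ofSet _ Z)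

theorem exists_contraction_of_isIso {Γ Γ' : HoloGraph 1 s} (h : IsIso Γ Γ') :
    ∃ p : Contraction Γ Γ', Function.Bijective p.onE := by
  obtain ⟨φ, hφ⟩ := h
  refine ⟨⟨LegGraph.Contraction.ofIso φ, fun e => ?_⟩, φ.onE.symm.bijective⟩
  rw [← hφ]
  exact congrArg Γ'.color (φ.onE.apply_symm_apply e)

/-- Isomorphism of colored graphs with `k` edges, as an equivalence relation. -/
instance isoSetoid (s k : ℕ) : Setoid {Γ : HoloGraph 1 s // Nat.card Γ.E = k} where
  r Γ Γ' := IsIso Γ.1 Γ'.1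
  iseqv := ⟨fun _ => ⟨LegGraph.Iso.refl _, fun _ => rfl⟩, IsIso.symm, IsIso.trans⟩

/-- The isomorphism classes of colored graphs with `k` edges. -/
def IsoClass (s k : ℕ) : Type 1 := Quotient (isoSetoid s k)

/-- The isomorphism class of a colored graph. -/
def isoClass {k : ℕ} (Γ : HoloGraph 1 s) (h : Nat.card Γ.E = k) : IsoClass s k :=
  Quotient.mk (isoSetoid s k) ⟨Γ, h⟩

theorem isoClass_eq_iff {k : ℕ} {Γ Γ' : HoloGraph 1 s} {h : Nat.card Γ.E = k}
    {h' : Nat.card Γ'.E = k} : Γ.isoClass h = Γ'.isoClass h' ↔ IsIso Γ Γ' :=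
  Quotient.eq

namespace IsoClass

variable {k : ℕ}

/-- A graph in an isomorphism class. -/
noncomputable def rep (a : IsoClass s k) : HoloGraph 1 s := (Quotient.out a).1

theorem card_rep (a : IsoClass s k) : Nat.card a.rep.E = k := (Quotient.out a).2

theorem isoClass_rep (a : IsoClass s k) : a.rep.isoClass a.card_rep = a := Quotient.out_eq a

theorem isIso_rep (Γ : HoloGraph 1 s) (h : Nat.card Γ.E = k) : IsIso Γ (Γ.isoClass h).rep :=
  isoClass_eq_iff.1 (isoClass_rep (Γ.isoClass h)).symm

/-- Contractions preserve colors, so ordering the edges by color makes all face maps order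
preserving. -/
theorem exists_edge (a : IsoClass s k) : ∃ f : Fin k ≃ a.rep.E, StrictMono (a.rep.color ∘ f) := by
  let : LinearOrder a.rep.E := LinearOrder.lift' a.rep.color a.rep.color_injective
  let f := Fintype.orderIsoFinOfCardEq a.rep.E (Nat.card_eq_fintype_card.symm.trans a.card_rep)
  exact ⟨f.toEquiv, f.strictMono⟩

/-- The edges of the representative, in the order of their colors. -/
noncomputable def edge (a : IsoClass s k) : Fin k ≃ a.rep.E := a.exists_edge.choose

theorem strictMono_edge (a : IsoClass s k) : StrictMono (a.rep.color ∘ a.edge) :=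
  a.exists_edge.choose_spec

/-- The simplex of all metrics on the representative. -/
noncomputable def simplex (a : IsoClass s k) (t : stdSimplex ℝ (Fin k)) : MHG 1 s :=
  a.rep.point (stdSimplex.map a.edge t)

theorem continuous_simplex (a : IsoClass s k) : Continuous a.simplex :=
  a.rep.continuous_point.comp (stdSimplex.continuous_map _)

theorem compl_singleton_ne (a : IsoClass s (k + 1)) (i : Fin (k + 1)) (hk : k ≠ 0) :
    ({a.edge i} : Set a.rep.E) ≠ Set.univ := by
  have : NeZero k := ⟨hk⟩
  intro h
  obtain ⟨j, hj⟩ := exists_ne i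
  exact hj (a.edge.injective (h ▸ Set.mem_univ (a.edge j) : a.edge j ∈ ({a.edge i} : Set a.rep.E)))

/-- The class of the graph in which the `i`-th edge is collapsed. -/
noncomputable def face (a : IsoClass s (k + 2)) (i : Fin (k + 2)) : IsoClass s (k + 1) :=
  (a.rep.contract {a.edge i} (a.compl_singleton_ne i k.succ_ne_zero)).isoClass (by
    have h := Set.ncard_add_ncard_compl ({a.edge i} : Set a.rep.E)
    rw [Set.ncard_singleton, a.card_rep] at h
    have h2 : Nat.card {e // e ∉ ({a.edge i} : Set a.rep.E)} = ({a.edge i} : Set a.rep.E)ᶜ.ncard :=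
      Nat.card_coe_set_eq _
    change Nat.card {e // e ∉ ({a.edge i} : Set a.rep.E)} = k + 1
    lia)

theorem simplex_face (a : IsoClass s (k + 2)) (i : Fin (k + 2)) (t : stdSimplex ℝ (Fin (k + 1))) :
    (a.face i).simplex t = a.simplex (stdSimplex.map i.succAbove t) := by
  have hf : IsIso (a.rep.contract {a.edge i} (a.compl_singleton_ne i k.succ_ne_zero))
    (a.face i).rep := isIso_rep _ _
  obtain ⟨p, hp⟩ := a.rep.exists_contraction (a.compl_singleton_ne i k.succ_ne_zero) hf
  have hcomp : p.onE ∘ (a.face i).edge = a.edge ∘ i.succAbove := by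
    have h1 : a.rep.color ∘ p.onE ∘ (a.face i).edge = a.rep.color ∘ a.edge ∘ i.succAbove := by
      -- Both sides list the colors of the surviving edges increasingly, so equal ranges suffice.
      rw [← StrictMono.range_inj]
      · rw [Set.range_comp a.rep.color, Set.range_comp a.rep.color,
          (a.face i).edge.surjective.range_comp, hp, Set.range_comp a.edge, Fin.range_succAbove,
          Set.image_compl_eq a.edge.bijective, Set.image_singleton]
      · convert (a.face i).strictMono_edge using 1
        funext j
        exact p.color_onE _
      · exact a.strictMono_edge.comp (Fin.strictMono_succAbove i)
    exact a.rep.color_injective.comp_left h1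
  rw [simplex, simplex, ← point_map p, stdSimplex.map_comp_apply, stdSimplex.map_comp_apply, hcomp]

theorem exists_equiv (Γ : HoloGraph 1 s) (h : Nat.card Γ.E = k) :
    ∃ f : Fin k ≃ Γ.E, ∀ t, (Γ.isoClass h).simplex t = Γ.point (stdSimplex.map f t) := by
  obtain ⟨p, hp⟩ := exists_contraction_of_isIso (isIso_rep Γ h)
  refine ⟨(Γ.isoClass h).edge.trans (Equiv.ofBijective _ hp), fun t => ?_⟩
  rw [simplex, ← point_map p, stdSimplex.map_comp_apply]
  rfl

end IsoClass

theorem exists_simplex (x : MHG 1 s) : ∃ (k : ℕ) (a : IsoClass s (k + 1))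
    (t : stdSimplex ℝ (Fin (k + 1))), (∀ i, 0 < t i) ∧ a.simplex t = x := by
  obtain ⟨Γ, l, rfl⟩ := exists_point x
  have hZ : {e | l e = 0} ≠ Set.univ := by
    intro h
    have h1 := stdSimplex.sum_eq_one l
    rw [Finset.sum_eq_zero fun e _ => (h ▸ Set.mem_univ e : e ∈ {e | l e = 0})] at h1
    exact zero_ne_one h1
  obtain ⟨k, hk⟩ : ∃ k, Nat.card (Γ.contract _ hZ).E = k + 1 := by
    have := (Γ.contract _ hZ).isCycle.nonempty_E
    exact Nat.exists_eq_succ_of_ne_zero Nat.card_pos.ne'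
  let a := (Γ.contract _ hZ).isoClass hk
  obtain ⟨p, hp⟩ := Γ.exists_contraction hZ (IsoClass.isIso_rep _ hk : IsIso _ a.rep)
  have hr : Set.range (p.onE ∘ a.edge) = {e | l e = 0}ᶜ := by
    rw [a.edge.surjective.range_comp, hp]
  obtain ⟨t, ht, ht'⟩ := stdSimplex.exists_map_eq (p.onE_injective.comp a.edge.injective) l
    (fun e he => by
      rw [hr] at he
      exact not_not.1 he)
  refine ⟨k, a, t, fun i => ?_, ?_⟩
  · rw [ht']
    refine lt_of_le_of_ne (stdSimplex.zero_le l _) (Ne.symm ?_)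
    have : (p.onE ∘ a.edge) i ∈ {e | l e = 0}ᶜ := hr ▸ ⟨i, rfl⟩
    exact this
  · rw [IsoClass.simplex, ← point_map p, stdSimplex.map_comp_apply, ht]

theorem isIso_of_simplex_eq {Γ Γ' : HoloGraph 1 s} {k k' : ℕ} {f : Fin k ≃ Γ.E}
    {f' : Fin k' ≃ Γ'.E} {t : stdSimplex ℝ (Fin k)} {t' : stdSimplex ℝ (Fin k')}
    (ht : ∀ i, 0 < t i) (ht' : ∀ i, 0 < t' i)
    (h : Γ.point (stdSimplex.map f t) = Γ'.point (stdSimplex.map f' t')) :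
    ∃ φ : LegGraph.Iso Γ.toLegGraph Γ'.toLegGraph, ∀ e, Γ'.color (φ.onE e) = Γ.color e ∧
      stdSimplex.map f' t' (φ.onE e) = stdSimplex.map f t e := by
  refine isIso_of_point_eq (fun e => ?_) (fun e => ?_) h
  · rw [← f.apply_symm_apply e, stdSimplex.map_apply_of_injective f.injective]
    exact ht _
  · rw [← f'.apply_symm_apply e, stdSimplex.map_apply_of_injective f'.injective]
    exact ht' _

theorem simplex_injective {k k' : ℕ} {a : IsoClass s (k + 1)} {a' : IsoClass s (k' + 1)}
    {t : stdSimplex ℝ (Fin (k + 1))} {t' : stdSimplex ℝ (Fin (k' + 1))}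
    (ht : ∀ i, 0 < t i) (ht' : ∀ i, 0 < t' i) (h : a.simplex t = a'.simplex t') :
    (⟨k, a, t⟩ : Σ k, IsoClass s (k + 1) × stdSimplex ℝ (Fin (k + 1))) = ⟨k', a', t'⟩ := by
  obtain ⟨φ, hφ⟩ := isIso_of_simplex_eq ht ht' h
  have hi : IsIso a.rep a'.rep := ⟨φ, fun e => (hφ e).1⟩
  obtain rfl : k = k' := by
    have := hi.card_eq
    rw [a.card_rep, a'.card_rep] at this
    lia
  obtain rfl : a = a' := by
    rw [← a.isoClass_rep, ← a'.isoClass_rep]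
    exact isoClass_eq_iff.2 hi
  congr 2
  refine stdSimplex.ext (funext fun i => ?_)
  have h1 := hφ (a.edge i)
  -- Colors are injective, so the isomorphism fixes every edge and the lengths agree coordinatewise.
  rw [a.rep.color_injective h1.1, stdSimplex.map_apply_of_injective a.edge.injective,
    stdSimplex.map_apply_of_injective a.edge.injective] at h1
  exact h1.2.symm

/-- The Δ-complex of colored graphs. -/
noncomputable def deltaComplex (s : ℕ) : DeltaComplex (MHG 1 s) where
  cell n := IsoClass s (n + 1)
  map a := ⟨a.simplex, a.continuous_simplex⟩
  existsUnique_interior x := by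
    obtain ⟨k, a, t, ht, rfl⟩ := exists_simplex x
    refine ⟨⟨k, a, t⟩, ⟨ht, rfl⟩, ?_⟩
    rintro ⟨k', a', t'⟩ ⟨ht', h⟩
    exact simplex_injective ht' ht h
  face a i := a.face i
  map_face a i t := a.simplex_face i t
  isOpen_iff A := by
    refine ⟨fun h n a => h.preimage a.continuous_simplex, fun h => ?_⟩
    rw [isOpen_iff]
    intro Γ
    obtain ⟨k, hk⟩ : ∃ k, Nat.card Γ.E = k + 1 := by
      have := Γ.isCycle.nonempty_E
      exact Nat.exists_eq_succ_of_ne_zero Nat.card_pos.ne'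
    obtain ⟨f, hf⟩ := IsoClass.exists_equiv Γ hk
    convert (h k (Γ.isoClass hk)).preimage (stdSimplex.continuous_map (S := ℝ) f.symm) using 1
    ext l
    change _ ↔ (Γ.isoClass hk).simplex (stdSimplex.map f.symm l) ∈ A
    rw [hf, stdSimplex.map_comp_apply]
    simp

theorem isGraphComplex_deltaComplex (s : ℕ) : (deltaComplex s).IsGraphComplex where
  exists_graph n a := ⟨a.rep, a.edge, fun _ => ⟨a.rep.isForest_zero _, rfl⟩⟩
  exists_cell Γ := by
    obtain ⟨k, hk⟩ : ∃ k, Nat.card Γ.E = k + 1 := by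
      have := Γ.isCycle.nonempty_E
      exact Nat.exists_eq_succ_of_ne_zero Nat.card_pos.ne'
    obtain ⟨f, hf⟩ := IsoClass.exists_equiv Γ hk
    exact ⟨k, Γ.isoClass hk, f, fun t => ⟨Γ.isForest_zero _, hf t⟩⟩

end HoloGraph

/-- The number of surjections between finite sets, by inclusion and exclusion. -/
theorem card_surjective (α β : Type*) [Fintype α] [Fintype β] :
    (Nat.card {f : α → β // Function.Surjective f} : ℤ) =
      ∑ j ∈ Finset.range (Fintype.card β + 1), (-1) ^ (Fintype.card β - j) *
        ((Fintype.card β).choose j : ℤ) * (j : ℤ) ^ Fintype.card α := by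
  classical
  let S (b : β) : Finset (α → β) := Finset.univ.filter fun f => ∀ a, f a ≠ b
  have h1 : Finset.univ.filter (fun f : α → β => Function.Surjective f) =
      Finset.univ.inf fun b => (S b)ᶜ := by
    ext f
    simp only [S, Finset.mem_filter, Finset.mem_univ, true_and, Finset.mem_inf,
      Finset.mem_compl, not_forall, not_not, forall_true_left]
    exact Iff.rfl
  have h2 (t : Finset β) : (t.inf S).card = (Fintype.card β - t.card) ^ Fintype.card α := by
    have : t.inf S = Fintype.piFinset fun _ => tᶜ := by
      ext f
      simp only [S, Finset.mem_inf, Finset.mem_filter, Finset.mem_univ, true_and,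
        Fintype.mem_piFinset, Finset.mem_compl]
      exact ⟨fun h a ha => h _ ha a rfl, fun h b hb a hab => h a (hab ▸ hb)⟩
    rw [this, Fintype.card_piFinset, Finset.prod_const, Finset.card_univ, Finset.card_compl]
  rw [Nat.card_eq_fintype_card, Fintype.card_subtype, h1,
    Finset.inclusion_exclusion_card_inf_compl]
  simp only [h2]
  rw [Finset.sum_powerset_apply_card
    (fun m => (-1 : ℤ) ^ m * (((Fintype.card β - m) ^ Fintype.card α : ℕ) : ℤ)), Finset.card_univ,
    ← Finset.sum_range_reflect]
  refine Finset.sum_congr rfl fun j hj => ?_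
  have hj : j ≤ Fintype.card β := Nat.lt_succ_iff.1 (Finset.mem_range.1 hj)
  rw [Nat.add_sub_cancel, Nat.choose_symm hj, Nat.sub_sub_self hj]
  push_cast
  rw [nsmul_eq_mul]
  ring

/-! ### Standard cycles and the count of isomorphism classes. -/

namespace LegGraph

variable {s k : ℕ}

/-- The cycle with `k` edges and prescribed legs. -/
def cycle (k : ℕ) [NeZero k] (l : Fin s → ZMod k) : LegGraph s where
  V := ZMod k
  E := ZMod k
  ends i := s(i, i + 1)
  leg := l

theorem conn_cycle [NeZero k] (l : Fin s → ZMod k) (e v w : ZMod k) :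
    (cycle k l).conn {e}ᶜ v w := by
  -- Starting just past the removed edge, `k - 1` steps reach every vertex without crossing it.
  have key (n : ℕ) (hn : n < k) : (cycle k l).conn {e}ᶜ (e + 1) (e + 1 + n : ZMod k) := by
    induction n with
    | zero => rw [Nat.cast_zero, add_zero]; exact ((cycle k l).conn {e}ᶜ).refl _
    | succ n ih =>
      refine ((cycle k l).conn {e}ᶜ).trans (ih (by lia)) ?_
      refine conn_of_mem (G := cycle k l) (e := (e + 1 + n : ZMod k)) ?_ ?_
      · change e + 1 + n ≠ e
        intro h
        have h1 : ((n + 1 : ℕ) : ZMod k) = 0 := by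
          push_cast
          linear_combination h
        rw [ZMod.natCast_eq_zero_iff] at h1
        exact absurd (Nat.le_of_dvd n.succ_pos h1) (by lia)
      · change s(_, _) = s(_, _)
        push_cast
        rw [add_assoc (e + 1)]
  have key' (v : ZMod k) : (cycle k l).conn {e}ᶜ (e + 1) v := by
    have h := key (v - (e + 1)).val (ZMod.val_lt _)
    rwa [ZMod.natCast_zmod_val, add_sub_cancel] at h
  exact ((cycle k l).conn {e}ᶜ).trans (((cycle k l).conn {e}ᶜ).symm (key' v)) (key' w)

theorem isCycle_cycle [NeZero k] (l : Fin s → ZMod k) : (cycle k l).IsCycle := by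
  have h (e : ZMod k) : (cycle k l).ConnectedOn {e}ᶜ :=
    connectedOn_iff.2 ⟨⟨(0 : ZMod k)⟩, conn_cycle l e⟩
  have h1 : (cycle k l).ConnectedOn Set.univ :=
    connectedOn_iff.2 ⟨⟨(0 : ZMod k)⟩, fun v w =>
      conn_mono (Set.subset_univ _) (conn_cycle l 0 v w)⟩
  refine ⟨⟨h1, h⟩, ?_⟩
  rw [rank_of_connectedOn h1]
  change (Nat.card (ZMod k) : ℤ) - Nat.card (ZMod k) + 1 = 1
  ring

end LegGraph

namespace HoloGraph

variable {s : ℕ}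

/-- Injective colorings of the edges of the cycle together with positions of the legs that occupy
every vertex. -/
abbrev CycleData (s k : ℕ) : Type :=
  (ZMod k ↪ Fin (3 * (1 - 1) + s)) × {l : Fin s → ZMod k // Function.Surjective l}

variable {k : ℕ}

/-- The colors and the legs of a graph whose vertices and edges are cyclically numbered. -/
def cycleData (Γ : HoloGraph 1 s) (F : LegGraph.CycleFrame k Γ.toLegGraph) : CycleData s k :=
  (⟨Γ.color ∘ F.onE, Γ.color_injective.comp F.onE.injective⟩,
    ⟨F.onV.symm ∘ Γ.leg, F.onV.symm.surjective.comp Γ.leg_surjective⟩)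

/-- Colors identify the edges, and legs identify the vertices because every vertex carries one. -/
theorem cycleData_injective (Γ : HoloGraph 1 s) :
    Function.Injective (Γ.cycleData : LegGraph.CycleFrame k Γ.toLegGraph → CycleData s k) := by
  intro F F' h
  obtain ⟨h1, h2⟩ := Prod.ext_iff.1 h
  have hE : F.onE = F'.onE :=
    Equiv.ext fun i => Γ.color_injective (DFunLike.congr_fun h1 i)
  have hV : F.onV = F'.onV := by
    refine Equiv.symm_bijective.injective (Equiv.ext fun v => ?_)
    obtain ⟨i, rfl⟩ := Γ.leg_surjective v
    exact congrFun (congrArg Subtype.val h2) i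
  cases F; cases F'
  simp only [LegGraph.CycleFrame.mk.injEq]
  exact ⟨hV, hE⟩

variable [NeZero k]

/-- The colored cycle with given colors and legs. -/
def ofCycleData (d : CycleData s k) : HoloGraph 1 s where
  toLegGraph := LegGraph.cycle k d.2.1
  admissible := (LegGraph.isCycle_cycle d.2.1).isAdmissible_iff.2 d.2.2
  rank_eq := by exact_mod_cast (LegGraph.isCycle_cycle d.2.1).rank_eq
  color := d.1
  color_injective := d.1.injective

theorem card_ofCycleData (d : CycleData s k) : Nat.card (ofCycleData d).E = k :=
  Nat.card_zmod k

theorem isIso_ofCycleData_iff (Γ : HoloGraph 1 s) (d : CycleData s k) :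
    IsIso (ofCycleData d) Γ ↔ ∃ F, Γ.cycleData F = d := by
  constructor
  · rintro ⟨φ, hφ⟩
    refine ⟨⟨φ.onV, φ.onE, fun i => φ.ends_onE i⟩, ?_⟩
    refine Prod.ext (DFunLike.ext _ _ fun i => hφ i) (Subtype.ext (funext fun i => ?_))
    exact (Equiv.symm_apply_eq _).2 (φ.leg_eq i)
  · rintro ⟨F, rfl⟩
    refine ⟨⟨F.onV, F.onE, fun i => F.ends_onE i, fun i => ?_⟩, fun e => rfl⟩
    exact (F.onV.apply_symm_apply _).symm

/-- An isomorphism from a standard cycle is the same as a cyclic numbering of the representative,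
and different numberings yield different data. -/
theorem card_fiber (a : IsoClass s k) :
    Nat.card {d : CycleData s k // (ofCycleData d).isoClass (card_ofCycleData d) = a} =
      k * if k = 1 then 1 else 2 := by
  rw [← a.rep.isCycle.card_cycleFrame a.card_rep]
  symm
  refine Nat.card_congr (Equiv.ofBijective (fun F => ⟨a.rep.cycleData F, ?_⟩) ⟨?_, ?_⟩)
  · exact (isoClass_eq_iff.2 ((isIso_ofCycleData_iff _ _).2 ⟨F, rfl⟩)).trans a.isoClass_rep
  · exact fun F F' h => a.rep.cycleData_injective (congrArg Subtype.val h)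
  · rintro ⟨d, hd⟩
    rw [← a.isoClass_rep, isoClass_eq_iff, isIso_ofCycleData_iff] at hd
    obtain ⟨F, hF⟩ := hd
    exact ⟨F, Subtype.ext hF⟩

instance : Finite (IsoClass s k) := by
  refine Finite.of_surjective
    (fun d : CycleData s k => (ofCycleData d).isoClass (card_ofCycleData d)) fun a => ?_
  have h := card_fiber a
  have : Nat.card {d : CycleData s k // (ofCycleData d).isoClass (card_ofCycleData d) = a} ≠ 0 := by
    rw [h]
    refine mul_ne_zero (NeZero.ne k) ?_
    split_ifs <;> decide
  obtain ⟨⟨d, hd⟩⟩ := (Nat.card_ne_zero.1 this).1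
  exact ⟨d, hd⟩

theorem card_cycleData_eq_mul :
    Nat.card (CycleData s k) = Nat.card (IsoClass s k) * (k * if k = 1 then 1 else 2) := by
  have := Fintype.ofFinite (IsoClass s k)
  rw [Nat.card_congr (Equiv.sigmaFiberEquiv
    (fun d : CycleData s k => (ofCycleData d).isoClass (card_ofCycleData d))).symm, Nat.card_sigma,
    Finset.sum_congr rfl fun a _ => card_fiber a, Finset.sum_const, Finset.card_univ,
    smul_eq_mul, Nat.card_eq_fintype_card]

theorem card_cycleData : (Nat.card (CycleData s k) : ℤ) = k.factorial * s.choose k *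
    ∑ j ∈ Finset.range (k + 1), (-1) ^ (k - j) * (k.choose j : ℤ) * (j : ℤ) ^ s := by
  rw [Nat.card_prod, Nat.cast_mul, card_surjective, Nat.card_eq_fintype_card,
    Fintype.card_embedding_eq, ZMod.card, Fintype.card_fin, Fintype.card_fin,
    Nat.descFactorial_eq_factorial_mul_choose]
  simp

theorem card_isoClass : (Nat.card (IsoClass s k) : ℚ) =
    ((k - 1).factorial : ℚ) / (2 - if k = 1 then 1 else 0) * (s.choose k : ℚ) *
      ∑ j ∈ Finset.range (k + 1), (-1 : ℚ) ^ (k - j) * (k.choose j : ℚ) * (j : ℚ) ^ s := by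
  have h1 := congrArg (Int.cast : ℤ → ℚ) (card_cycleData (s := s) (k := k))
  rw [card_cycleData_eq_mul] at h1
  obtain ⟨m, rfl⟩ := Nat.exists_eq_succ_of_ne_zero (NeZero.ne k)
  push_cast [Nat.factorial_succ] at h1
  have hm : (m : ℚ) + 1 ≠ 0 := by positivity
  have hd : (if m = 0 then (1 : ℚ) else 2) = 2 - if m + 1 = 1 then 1 else 0 := by
    simp only [Nat.add_eq_right]
    split_ifs <;> norm_num
  have hd' : (2 : ℚ) - (if m + 1 = 1 then 1 else 0) ≠ 0 := by
    split_ifs <;> norm_num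
  simp only [Nat.succ_eq_add_one] at h1 ⊢
  rw [hd] at h1
  rw [Nat.add_sub_cancel, div_mul_eq_mul_div, div_mul_eq_mul_div, eq_div_iff hd']
  refine mul_left_cancel₀ hm ?_
  linear_combination h1

end HoloGraph

/-! ### Independence of the Δ-complex structure. -/

namespace DeltaComplex.IsGraphComplex

open HoloGraph

variable {s : ℕ} {K : DeltaComplex (MHG 1 s)}

theorem map_barycenter {X Y : Type*} [Fintype X] [Fintype Y] [Nonempty X]
    (f g : X ≃ Y) : stdSimplex.map f (stdSimplex.barycenter : stdSimplex ℝ X) =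
      stdSimplex.map g (stdSimplex.barycenter : stdSimplex ℝ X) := by
  refine stdSimplex.ext (funext fun y => ?_)
  obtain ⟨x, rfl⟩ := f.surjective y
  obtain ⟨x', h⟩ := g.surjective (f x)
  rw [stdSimplex.map_apply_of_injective f.injective, ← h,
    stdSimplex.map_apply_of_injective g.injective]
  exact (stdSimplex.barycenter_apply x).trans (stdSimplex.barycenter_apply x').symm

theorem barycenter_pos (n : ℕ) (i : Fin (n + 1)) :
    0 < (stdSimplex.barycenter : stdSimplex ℝ (Fin (n + 1))) i := by
  refine lt_of_lt_of_eq ?_ (stdSimplex.barycenter_apply i).symm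
  simp only [Fintype.card_fin]
  positivity

/-- The vertex numbering of a cell is arbitrary, but the barycenter does not depend on it. Being an
interior point, its image determines the cell, and its positive lengths determine the graph. -/
theorem nonempty_equiv (hK : K.IsGraphComplex) (n : ℕ) :
    Nonempty (K.cell n ≃ IsoClass s (n + 1)) := by
  choose Γ f hf using hK.exists_graph n
  replace hf (a t) : K.map a t = (Γ a).point (stdSimplex.map (f a) t) := (hf a t).2
  have hc (a) : Nat.card (Γ a).E = n + 1 := by
    rw [← Nat.card_congr (f a), Nat.card_fin]
  refine ⟨Equiv.ofBijective (fun a => (Γ a).isoClass (hc a)) ⟨fun a b h => ?_, fun x => ?_⟩⟩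
  · obtain ⟨p, hp⟩ := exists_contraction_of_isIso (isoClass_eq_iff.1 h)
    have h1 : K.map a stdSimplex.barycenter = K.map b stdSimplex.barycenter := by
      rw [hf, hf, ← point_map p, stdSimplex.map_comp_apply]
      exact congrArg (Γ a).point (map_barycenter (f a) ((f b).trans (Equiv.ofBijective _ hp)))
    have := (K.existsUnique_interior (K.map b stdSimplex.barycenter)).unique
      (y₁ := ⟨n, a, stdSimplex.barycenter⟩) (y₂ := ⟨n, b, stdSimplex.barycenter⟩)
      ⟨barycenter_pos n, h1⟩ ⟨barycenter_pos n, rfl⟩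
    simpa using this
  · obtain ⟨m, a, g, hg⟩ := hK.exists_cell x.rep
    obtain rfl : m = n := by
      have := Nat.card_congr g
      rw [Nat.card_fin, x.card_rep] at this
      lia
    refine ⟨a, ?_⟩
    rw [← x.isoClass_rep, isoClass_eq_iff]
    have h1 : (Γ a).point (stdSimplex.map (f a) stdSimplex.barycenter) =
        x.rep.point (stdSimplex.map g stdSimplex.barycenter) :=
      (hf a _).symm.trans (hg _).2
    obtain ⟨φ, hφ⟩ := isIso_of_simplex_eq (barycenter_pos m) (barycenter_pos m) h1
    exact ⟨φ, fun e => (hφ e).1⟩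

theorem finite_cell (hK : K.IsGraphComplex) (n : ℕ) : Finite (K.cell n) := by
  obtain ⟨e⟩ := hK.nonempty_equiv n
  exact Finite.of_equiv _ e.symm

theorem card_cell (hK : K.IsGraphComplex) (n : ℕ) : (Nat.card (K.cell n) : ℚ) =
    (n.factorial : ℚ) / (2 - if n + 1 = 1 then 1 else 0) * (s.choose (n + 1) : ℚ) *
      ∑ j ∈ Finset.range (n + 1 + 1),
        (-1 : ℚ) ^ (n + 1 - j) * ((n + 1).choose j : ℚ) * (j : ℚ) ^ s := by
  obtain ⟨e⟩ := hK.nonempty_equiv n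
  rw [Nat.card_congr e, card_isoClass, Nat.add_sub_cancel]

end DeltaComplex.IsGraphComplex

/-! ### Euler characteristics from ranks of chain groups. -/

theorem CategoryTheory.ShortComplex.finrank_homology_add {K : Type*} [Field K]
    (S : ShortComplex (ModuleCat K)) [Module.Finite K S.X₂] :
    Module.finrank K S.homology + Module.finrank K (LinearMap.range S.f.hom) +
      Module.finrank K (LinearMap.range S.g.hom) = Module.finrank K S.X₂ := by
  have h1 : Module.finrank K S.homology =
      Module.finrank K (LinearMap.ker S.g.hom ⧸ LinearMap.range S.moduleCatToCycles) :=
    S.moduleCatHomologyIso.toLinearEquiv.finrank_eq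
  have h2 := Submodule.finrank_quotient_add_finrank (LinearMap.range S.moduleCatToCycles)
  have h3 := LinearMap.finrank_range_add_finrank_ker S.g.hom
  have h4 : Module.finrank K (LinearMap.range S.moduleCatToCycles) =
      Module.finrank K (LinearMap.range S.f.hom) := by
    have hle : LinearMap.range S.f.hom ≤ LinearMap.ker S.g.hom := by
      rintro _ ⟨x, rfl⟩
      exact S.moduleCat_zero_apply x
    have h5 : LinearMap.range S.moduleCatToCycles =
        (LinearMap.range S.f.hom).comap (LinearMap.ker S.g.hom).subtype :=
      LinearMap.range_codRestrict _ _ _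
    rw [h5]
    exact (Submodule.comapSubtypeEquivOfLe hle).finrank_eq
  rw [h1, ← h4]
  lia

theorem ChainComplex.finrank_homology_add {K : Type*} [Field K]
    (C : ChainComplex (ModuleCat K) ℕ) (i : ℕ) [Module.Finite K (C.X i)] :
    Module.finrank K (C.homology i) + Module.finrank K (LinearMap.range (C.d (i + 1) i).hom) +
      Module.finrank K (LinearMap.range (C.d i (i - 1)).hom) = Module.finrank K (C.X i) := by
  -- At `i = 0` the successor in the complex shape is 0 itself, matching the truncated `i - 1`.
  have key (j k : ℕ) (hj : (ComplexShape.down ℕ).prev i = j)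
      (hk : (ComplexShape.down ℕ).next i = k) :
      Module.finrank K (C.homology i) + Module.finrank K (LinearMap.range (C.d j i).hom) +
        Module.finrank K (LinearMap.range (C.d i k).hom) = Module.finrank K (C.X i) := by
    subst hj hk
    have : Module.Finite K (C.sc i).X₂ := inferInstanceAs (Module.Finite K (C.X i))
    exact (C.sc i).finrank_homology_add
  refine key _ _ (ChainComplex.prev ℕ i) ?_
  cases i with
  | zero => exact ChainComplex.next_nat_zero
  | succ i => exact ChainComplex.next_nat_succ i

theorem ChainComplex.homologyEulerChar_eq_sum {K : Type*} [Field K]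
    (C : ChainComplex (ModuleCat K) ℕ) [∀ i, Module.Finite K (C.X i)] (N : ℕ)
    (hN : ∀ i, N ≤ i → Module.finrank K (C.X i) = 0) :
    C.homologyEulerChar = ∑ i ∈ Finset.range N, (-1) ^ i * (Module.finrank K (C.X i) : ℤ) := by
  have h (i : ℕ) := C.finrank_homology_add i
  rw [HomologicalComplex.homologyEulerChar_eq_sum_finSet_of_finrankSupport_subset C
    (Finset.range N)]
  -- The homology and chain sums differ by the telescoping sum of `r (i + 1) - r i`, and `r`
  -- vanishes at both ends.
  · let r (i : ℕ) : ℤ := (-1) ^ i * Module.finrank K (LinearMap.range (C.d i (i - 1)).hom)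
    have hr0 : r 0 = 0 := by
      have : C.d 0 (0 - 1) = 0 := C.shape _ _ (by simp)
      simp only [r]
      rw [this, ModuleCat.hom_zero, LinearMap.range_zero]
      simp
    have hrN : r N = 0 := by
      have := h N
      rw [hN N le_rfl] at this
      simp only [r]
      rw [show Module.finrank K (LinearMap.range (C.d N (N - 1)).hom) = 0 by lia]
      simp
    have h1 := Finset.sum_range_sub r N
    rw [hr0, hrN, sub_zero] at h1
    rw [← sub_eq_zero, ← h1, ← Finset.sum_sub_distrib]
    refine Finset.sum_congr rfl fun i _ => ?_
    have hi := h i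
    have hr : r (i + 1) = (-1) ^ (i + 1) *
      Module.finrank K (LinearMap.range (C.d (i + 1) i).hom) := rfl
    rw [hr]
    simp only [r, ComplexShape.eulerCharSignsDownNat_χ, pow_succ]
    push_cast
    rw [← hi]
    push_cast
    ring
  · rw [GradedObject.finrankSupport_subset_iff]
    intro i hi
    have h1 := h i
    rw [hN i (by simpa using hi)] at h1
    lia

theorem DeltaComplex.eulerChar_eq_sum {X : Type*} [TopologicalSpace X] (K : DeltaComplex X)
    [∀ n, Finite (K.cell n)] (N : ℕ) (hN : ∀ n, N ≤ n → IsEmpty (K.cell n)) :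
    K.eulerChar = ∑ n ∈ Finset.range N, (-1) ^ n * (Nat.card (K.cell n) : ℤ) := by
  have hX (n : ℕ) : K.chainComplex.X n = ModuleCat.of ℚ (K.cell n →₀ ℚ) := rfl
  have hfin (n : ℕ) : Module.Finite ℚ (K.chainComplex.X n) :=
    inferInstanceAs (Module.Finite ℚ (K.cell n →₀ ℚ))
  have hrank (n : ℕ) : Module.finrank ℚ (K.chainComplex.X n) = Nat.card (K.cell n) := by
    have := Fintype.ofFinite (K.cell n)
    exact (Module.finrank_finsupp_self ℚ).trans Nat.card_eq_fintype_card.symm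
  rw [eulerChar, ChainComplex.homologyEulerChar_eq_sum _ N]
  · simp only [hrank]
  · intro n hn
    have := hN n hn
    rw [hrank, Nat.card_of_isEmpty]

theorem mainTheorem10 (s : ℕ) :
    (∃ K : DeltaComplex (MHG 1 s), K.IsGraphComplex) ∧
    ∀ K : DeltaComplex (MHG 1 s), K.IsGraphComplex →
      (∀ k : ℕ, 1 ≤ k → Finite (K.cell (k - 1)) ∧
        (Nat.card (K.cell (k - 1)) : ℚ) =
          ((k - 1).factorial : ℚ) / (2 - if k = 1 then 1 else 0) * (s.choose k : ℚ) *
            ∑ j ∈ Finset.range (k + 1), (-1 : ℚ) ^ (k - j) * (k.choose j : ℚ) * (j : ℚ) ^ s) ∧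
      (K.eulerChar : ℚ) =
        ∑ k ∈ Finset.Icc 1 s, ∑ j ∈ Finset.range (k + 1),
          (-1 : ℚ) ^ (j + 1) * ((j : ℚ) ^ s * ((k - 1).factorial : ℚ) /
            (2 - if k = 1 then 1 else 0)) * (s.choose k : ℚ) * (k.choose j : ℚ) := by
  refine ⟨⟨_, HoloGraph.isGraphComplex_deltaComplex s⟩, fun K hK => ⟨fun k hk => ?_, ?_⟩⟩
  · obtain ⟨n, rfl⟩ := Nat.exists_eq_add_of_le' hk
    exact ⟨hK.finite_cell n, hK.card_cell n⟩
  · have hfin := hK.finite_cell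
    -- Cells of dimension at least `s` would need more than `s` colors, so the binomial coefficient
    -- vanishes.
    rw [K.eulerChar_eq_sum s]
    · rw [← Finset.Ico_add_one_right_eq_Icc, Finset.sum_Ico_eq_sum_range, Nat.add_sub_cancel]
      push_cast
      refine Finset.sum_congr rfl fun n _ => ?_
      rw [hK.card_cell n, add_comm 1 n, Finset.mul_sum, Finset.mul_sum, Nat.add_sub_cancel]
      refine Finset.sum_congr rfl fun j hj => ?_
      have hj : j ≤ n + 1 := Nat.lt_succ_iff.1 (Finset.mem_range.1 hj)
      have hsign : (-1 : ℚ) ^ n * (-1) ^ (n + 1 - j) = (-1) ^ (j + 1) := by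
        obtain ⟨m, hm⟩ := Nat.exists_eq_add_of_le hj
        rw [hm, Nat.add_sub_cancel_left, ← pow_add]
        -- With `n + 1 = j + m`, the exponents `n + m` and `j + 1` have the same parity.
        have h1 : n + m + 2 * (j + 1) = (j + 1) + 2 * (n + 1) := by lia
        have h2 := congrArg (fun e => (-1 : ℚ) ^ e) h1
        simpa [pow_add, pow_mul] using h2
      rw [← hsign]
      ring
    · intro n hn
      have h := hK.card_cell n
      rw [Nat.choose_eq_zero_of_lt (by lia), Nat.cast_zero, mul_zero, zero_mul] at h
      exact Finite.card_eq_zero_iff.1 (by exact_mod_cast h)
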